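/- Let $N$ be a totally real Galois extension of $\mathbb{Q}$ with $\mathrm{Gal}(N/\mathbb{Q})\simeq S_3$, let $K$ be its quadratic subfield and $L$ one of its cubic subfields. For a number field $F$ let $\mathcal{I}_F\ge\mathcal{P}_F$ be the groups of fractional and of principal fractional ideals and $U_F$ the unit group of the ring of integers. For a cubic extension $E/F$ regard $\mathcal{I}_F$ as a subgroup of $\mathcal{I}_E$ via extension of ideals, and put $\mathcal{I}_{E/F}=\{\mathfrak{A}\in\mathcal{I}_E\mid\mathfrak{A}^3\in\mathcal{I}_F\}$ and $\mathcal{P}_{E/F}=\mathcal{I}_{E/F}\cap\mathcal{P}_E$. Define the $\mathbb{F}_3$-dimensions \[ \begin{aligned} U&=\dim\,U_K/N_{N/K}(U_N), \qquad A=\dim\,\mathcal{P}_{L/\mathbb{Q}}/\mathcal{P}_{\mathbb{Q}},\\ R&=\dim\Bigl(\ker\bigl(N_{N/L}:\mathcal{I}_{N/K}/\mathcal{I}_K\to\mathcal{I}_{L/\mathbb{Q}}/\mathcal{I}_{\mathbb{Q}}\bigr)\cap\bigl(\mathcal{P}_{N/K}\mathcal{I}_K/\mathcal{I}_K\bigr)\Bigr),\\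 C&=\dim\ker(\mathrm{Cl}_K\to\mathrm{Cl}_N), \end{aligned} \] where $\mathrm{Cl}_K\to\mathrm{Cl}_N$ is induced by extension of ideals. The field $N$ has type $\delta_1$ if $(U,A,R,C)=(0,0,0,1)$, and type $\varepsilon$ if $(U,A,R,C)=(0,1,0,0)$. Let the positive integer $f$ be the conductor of the cyclic cubic extension $N/K$. 1. If $N/K$ is unramified (that is, $f=1$) and the $3$-class rank $\varrho_3(K)=\dim_{\mathbb{F}_3}\mathrm{Cl}_K/\mathrm{Cl}_K^3$ equals $1$, then $N$ has type $\delta_1$. 2. If $f$ has exactly one prime divisor, this prime does not split in $K$, and the class number $h_K$ is not divisible by $3$, then $N$ has type $\varepsilon$. In both cases there is a unit $H\in U_N$ such that $N_{N/K}(H)$ is a fundamental unit of $K$. -/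

import Mathlib

open NumberField nonZeroDivisors

noncomputable section

namespace DPF

/-! ### Dimensions over `𝔽₃` -/

/-- The `3`-rank of an abelian group `G`, i.e. the `𝔽₃`-dimension of `G / G³`, as a cardinal.
If `G` is killed by `3`, then this is the dimension of `G` itself as an `𝔽₃`-vector space. -/
def rankThree (G : Type*) [CommGroup G] : Cardinal :=
  Module.rank (ZMod 3) (ModN (Additive G) 3)

/-! ### Groups of fractional ideals -/

/-- The group `I_F` of nonzero fractional ideals of a number field `F`. -/
abbrev IdealGroup (F : Type*) [Field F] : Type _ :=
  (FractionalIdeal (𝓞 F)⁰ F)ˣ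

/-- The subgroup `P_F` of principal fractional ideals in `I_F`. -/
def principalIdeals (F : Type*) [Field F] [NumberField F] : Subgroup (IdealGroup F) :=
  (toPrincipalIdeal (𝓞 F) F).range

section Extension

variable (F E : Type*) [Field F] [Field E] [NumberField F] [NumberField E] [Algebra F E]

/-- Extension of ideals `𝔞 ↦ 𝔞 𝓞_E`, by which `I_F` is regarded as a subgroup of `I_E`. -/
def extendIdeal : IdealGroup F →* IdealGroup E :=
  Units.map (FractionalIdeal.extendedHom (A := 𝓞 F) (K := F) E (𝓞 E)).toMonoidHom

/-- `I_F` as a subgroup of `I_E`. -/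
def baseIdeals : Subgroup (IdealGroup E) :=
  (extendIdeal F E).range

/-- `P_F` as a subgroup of `I_E`. -/
def basePrincipalIdeals : Subgroup (IdealGroup E) :=
  (principalIdeals F).map (extendIdeal F E)

/-- The group `I_{E/F} = {𝔄 ∈ I_E ∣ 𝔄³ ∈ I_F}` of ambiguous ideals of a cubic extension `E/F`. -/
def ambiguousIdeals : Subgroup (IdealGroup E) :=
  (baseIdeals F E).comap (powMonoidHom 3)

/-- The group `P_{E/F} = I_{E/F} ∩ P_E` of ambiguous principal ideals of `E/F`. -/
def ambiguousPrincipalIdeals : Subgroup (IdealGroup E) :=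
  ambiguousIdeals F E ⊓ principalIdeals E

/-- The space `P_{E/F} / P_F` of primitive ambiguous principal ideals of `E/F`
(differential principal factors). -/
abbrev PrincipalFactors : Type _ :=
  ambiguousPrincipalIdeals F E ⧸
    (basePrincipalIdeals F E).subgroupOf (ambiguousPrincipalIdeals F E)

/-! ### The relative ideal norm -/

theorem fractional_num_den (A : FractionalIdeal (𝓞 E)⁰ E) :
    ((Ideal.span {(A.den : 𝓞 E)} : Ideal (𝓞 E)) : FractionalIdeal (𝓞 E)⁰ E) * A
      = (A.num : FractionalIdeal (𝓞 E)⁰ E) := by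
  rw [FractionalIdeal.coeIdeal_span_singleton, FractionalIdeal.den_mul_self_eq_num']

/-- The relative norm `𝔄 ↦ N_{E/F}(𝔄)` on fractional ideals: for `𝔄 = 𝔟 / (d)` with an integral
ideal `𝔟` and `d ∈ 𝓞_E`, it is the quotient of the norms of the integral ideals `𝔟` and `(d)`. -/
def fractionalNorm : FractionalIdeal (𝓞 E)⁰ E →* FractionalIdeal (𝓞 F)⁰ F where
  toFun A := (Ideal.relNorm (𝓞 F) A.num : FractionalIdeal (𝓞 F)⁰ F) /
    (Ideal.relNorm (𝓞 F) (Ideal.span {(A.den : 𝓞 E)}) : FractionalIdeal (𝓞 F)⁰ F)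
  map_one' := by
    have h := fractional_num_den E 1
    rw [mul_one] at h
    rw [← FractionalIdeal.coeIdeal_inj.mp h, div_self]
    rw [Ne, FractionalIdeal.coeIdeal_eq_zero, Ideal.relNorm_eq_bot_iff,
      Ideal.span_singleton_eq_bot]
    exact nonZeroDivisors.coe_ne_zero _
  map_mul' A B := by
    have hA := fractional_num_den E A
    have hB := fractional_num_den E B
    have hC := fractional_num_den E (A * B)
    have h0 (X : FractionalIdeal (𝓞 E)⁰ E) :
        (Ideal.relNorm (𝓞 F) (Ideal.span {(X.den : 𝓞 E)}) : FractionalIdeal (𝓞 F)⁰ F) ≠ 0 := by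
      rw [Ne, FractionalIdeal.coeIdeal_eq_zero, Ideal.relNorm_eq_bot_iff,
        Ideal.span_singleton_eq_bot]
      exact nonZeroDivisors.coe_ne_zero _
    have key : (A * B).num * (Ideal.span {(A.den : 𝓞 E)} * Ideal.span {(B.den : 𝓞 E)})
        = A.num * B.num * Ideal.span {((A * B).den : 𝓞 E)} := by
      apply FractionalIdeal.coeIdeal_injective (K := E)
      simp only [FractionalIdeal.coeIdeal_mul]
      rw [← hA, ← hB, ← hC]
      ring
    rw [div_mul_div_comm, div_eq_div_iff (h0 _) (mul_ne_zero (h0 _) (h0 _))]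
    simp only [← FractionalIdeal.coeIdeal_mul, ← map_mul]
    rw [key]

/-- The relative norm `N_{E/F} : I_E → I_F`. -/
def idealNorm : IdealGroup E →* IdealGroup F :=
  Units.map (fractionalNorm F E)

end Extension

/-! ### The invariants `U`, `A`, `R`, `C` -/

section Invariants

/-- The norm map `N_{N/K} : U_N → U_K` on the unit groups of the rings of integers. -/
def unitNorm (K N : Type*) [Field K] [Field N] [NumberField K] [NumberField N]
    [Algebra K N] : (𝓞 N)ˣ →* (𝓞 K)ˣ :=
  Units.map (RingOfIntegers.norm K (L := N))

/-- The `𝔽₃`-dimension `U` of `U_K / N_{N/K}(U_N)` for a cubic extension `N/K`. -/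
def invariantU (K N : Type*) [Field K] [Field N] [NumberField K] [NumberField N]
    [Algebra K N] : Cardinal :=
  rankThree ((𝓞 K)ˣ ⧸ (unitNorm K N).range)

/-- The dimension `A` of the space `P_{L/ℚ} / P_ℚ` of absolute principal factors. -/
def invariantA (L : Type*) [Field L] [NumberField L] : Cardinal :=
  rankThree (PrincipalFactors ℚ L)

/-- The subgroup of `I_N` consisting of the ideals in `P_{N/K} I_K` whose class modulo `I_K` lies in
the kernel of the norm map `I_{N/K} / I_K → I_{L/ℚ} / I_ℚ` induced by `N_{N/L}`. -/
def relativePrincipalIdeals (K L N : Type*) [Field K] [Field L] [Field N]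
    [NumberField K] [NumberField L] [NumberField N] [Algebra K N] [Algebra L N] :
    Subgroup (IdealGroup N) :=
  (ambiguousPrincipalIdeals K N ⊔ baseIdeals K N) ⊓ (baseIdeals ℚ L).comap (idealNorm L N)

/-- The dimension `R` of the space `ker(N_{N/L}) ∩ (P_{N/K} I_K / I_K)` of relative principal
factors. -/
def invariantR (K L N : Type*) [Field K] [Field L] [Field N]
    [NumberField K] [NumberField L] [NumberField N] [Algebra K N] [Algebra L N] : Cardinal :=
  rankThree (relativePrincipalIdeals K L N ⧸
    (baseIdeals K N).subgroupOf (relativePrincipalIdeals K L N))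

/-- The dimension `C` of the capitulation kernel, i.e. of the kernel of the extension homomorphism
`Cl_K → Cl_N`, for a cubic extension `N/K`. -/
def invariantC (K N : Type*) [Field K] [Field N] [NumberField K] [NumberField N]
    [Algebra K N] : Cardinal :=
  rankThree (ClassGroup.extendedHom (𝓞 K) (𝓞 N)).ker

end Invariants

/-! ### Differential principal factorization types -/

/-- The nine differential principal factorization types of totally real `S₃`-fields. -/
inductive PFType
  | alpha1 | alpha2 | alpha3 | beta1 | beta2 | gamma | delta1 | delta2 | epsilon

/-- The values `(U, A, R, C)` which characterize each type. -/
def PFType.invariants : PFType → ℕ × ℕ × ℕ × ℕ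
  | .alpha1 => (1, 0, 0, 2)
  | .alpha2 => (1, 0, 1, 1)
  | .alpha3 => (1, 0, 2, 0)
  | .beta1 => (1, 1, 0, 1)
  | .beta2 => (1, 1, 1, 0)
  | .gamma => (1, 2, 0, 0)
  | .delta1 => (0, 0, 0, 1)
  | .delta2 => (0, 0, 1, 0)
  | .epsilon => (0, 1, 0, 0)

/-- `HasType K L N τ`: the totally real `S₃`-field `N`, with quadratic subfield `K` and cubic
subfield `L`, has differential principal factorization type `τ`. -/
def HasType (K L N : Type*) [Field K] [Field L] [Field N]
    [NumberField K] [NumberField L] [NumberField N] [Algebra K N] [Algebra L N]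
    (τ : PFType) : Prop :=
  invariantU K N = (τ.invariants.1 : Cardinal) ∧
  invariantA L = (τ.invariants.2.1 : Cardinal) ∧
  invariantR K L N = (τ.invariants.2.2.1 : Cardinal) ∧
  invariantC K N = (τ.invariants.2.2.2 : Cardinal)

/-! ### Ramification, conductor, units -/

section Conductor

variable (K N : Type*) [Field K] [Field N] [NumberField K] [NumberField N] [Algebra K N]

/-- `N/K` is unramified at all finite primes. -/
def IsUnramifiedExtension : Prop :=
  ∀ (P : Ideal (𝓞 N)) [P.IsPrime], Algebra.IsUnramifiedAt (𝓞 K) P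

/-- The ramification group `G_i` (lower numbering) of a prime `P` of `N`: all `σ ∈ Gal(N/K)` with
`σ x ≡ x mod P ^ (i + 1)` for all `x ∈ 𝓞_N`. -/
def ramificationGroup (P : Ideal (𝓞 N)) (i : ℕ) : Subgroup (N ≃ₐ[K] N) :=
  (P ^ (i + 1)).inertia (N ≃ₐ[K] N)

/-- The exponent of the prime `p` of `K` in the conductor of an extension `N/K` which is cyclic of
prime degree: the number of `i ≥ 0` with nontrivial `G_i(P)`, for `P` above `p`. It is the Artin
conductor exponent `∑ i, (#G_i / #G_0) codim (V ^ G_i)` of a faithful character of `Gal(N/K)`.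
All primes `P` above `p` have the same ramification groups, since `Gal(N/K)` is abelian. -/
def conductorExponent (p : Ideal (𝓞 K)) : ℕ :=
  {i : ℕ | ∃ P ∈ p.primesOver (𝓞 N), ramificationGroup K N P i ≠ ⊥}.ncard

/-- The conductor ideal `∏ p ^ (conductorExponent p)` of `N/K`, cyclic of prime degree. The product
of powers of distinct primes is written as their intersection. -/
def conductorIdeal : Ideal (𝓞 K) :=
  ⨅ v : IsDedekindDomain.HeightOneSpectrum (𝓞 K), v.asIdeal ^ conductorExponent K N v.asIdeal

/-- The conductor of `N/K` as a positive integer `f`: the least positive integer contained in the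
conductor ideal. If `N` is an `S₃`-field and `K` its quadratic subfield, then the conductor
ideal is `f 𝓞_K`. -/
def conductor : ℕ :=
  sInf {f : ℕ | 0 < f ∧ (f : 𝓞 K) ∈ conductorIdeal K N}

end Conductor

/-- The rational prime `q` does not split in the quadratic field `K`: there is only one prime ideal
of `K` above `q`, i.e. `q` is inert or ramified. -/
def DoesNotSplit (K : Type*) [Field K] (q : ℕ) : Prop :=
  ((Ideal.span {(q : ℤ)}).primesOver (𝓞 K)).ncard = 1

/-- `η` is a fundamental unit of the real quadratic field `K`: it generates the unit group together
with the roots of unity. -/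
def IsFundamentalUnit (K : Type*) [Field K] [NumberField K] (η : (𝓞 K)ˣ) : Prop :=
  Subgroup.zpowers η ⊔ NumberField.Units.torsion K = ⊤

end DPF

end

/-! Let σ generate Gal(N/K), let V be the group of units of N with relative norm 1, and put X =
P_{N/K}/P_K. Hilbert 90 attaches to v in V the ideal (β) with σβ = vβ, and this embeds V/U_N^{σ-1}
into X. Suppose every nontrivial element of X generates X; then V/U_N^{σ-1} has order at most 3. On
V the operator (σ-1)² is cubing up to an automorphism, and V is free of rank at least 4, so [V :
V^{σ-1}] ≥ 9. This index is the product of [V : U_N^{σ-1}] and [N(U_N) : U_K³], both at most 3.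
Hence both equal 3, every unit of K is a norm, and X is nontrivial (`range_norm_eq_fixed`,
`unitNorm_surjective`). This yields U = 0 and the unit H in both cases.

It remains to bound X and to locate its generator. If N/K is unramified, I_{N/K} = I_K, so X is the
capitulation kernel. It lies in the 3-torsion of Cl_K, which has order 3 by the rank hypothesis. So
C = 1; as all ambiguous ideals of N come from K, and then those of L from ℚ, also A = R = 0
(`hasType_delta1`). If at most one prime p of K ramifies, the valuation of 𝔄³ at p modulo 3 embeds
I_{N/K}/I_K into ℤ/3. Since 3 does not divide h_K, nothing capitulates, so C = 0 and X embeds into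
the same group. The conjugation τ of N/L fixes p and acts trivially on I_{N/K}/I_K, so there 𝔄·τ𝔄,
the extension of the norm to L, is 𝔄². The norm to L is therefore injective, which gives R = 0, and
it carries a generator of X to a generator of P_{L/ℚ}/P_ℚ, which gives A = 1 (`hasType_epsilon`). -/

noncomputable section

namespace DPF

open IsDedekindDomain

/-! ### Index computations for an automorphism of order three. -/

section HerbrandIndex

variable {U : Type*} [CommGroup U]

theorem relIndex_map_eq_index_sup (f : U →* U) (H : Subgroup U) :
    (H.map f).relIndex f.range = (H ⊔ f.ker).index := by
  have h := Subgroup.relIndex_map_map f H ⊤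
  rw [← MonoidHom.range_eq_map] at h
  rw [h, top_sup_eq, Subgroup.relIndex_top_right]

/-- Herbrand quotient computation for a group with an automorphism of order three. -/
theorem range_norm_eq_fixed (s : U →* U) (hs : ∀ x, s (s (s x)) = x)
    (φ ν : U →* U) (hφ : ∀ x, φ x = s x / x) (hν : ∀ x, ν x = x * s x * s (s x))
    (htf : ∀ x ∈ ν.ker, x ^ 3 = 1 → x = 1)
    (hcube : 81 ≤ (ν.ker.map (powMonoidHom 3)).relIndex ν.ker)
    (hV : φ.range.relIndex ν.ker ≤ 3)
    (hF : (φ.ker.map (powMonoidHom 3)).relIndex φ.ker ≤ 3)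
    (hF0 : (φ.ker.map (powMonoidHom 3)).relIndex φ.ker ≠ 0) :
    ν.range = φ.ker ∧ φ.range.relIndex ν.ker = 3 := by
  have memV : ∀ x, x ∈ ν.ker ↔ x * s x * s (s x) = 1 := fun x => by rw [MonoidHom.mem_ker, hν]
  have memF : ∀ x, x ∈ φ.ker ↔ s x = x := fun x => by
    rw [MonoidHom.mem_ker, hφ, div_eq_one]
  have hνs : ∀ x, s (ν x) = ν x := fun x => by
    rw [hν, map_mul, map_mul, hs, mul_comm, mul_assoc]
  have hφV : φ.range ≤ ν.ker := by
    rintro _ ⟨x, rfl⟩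
    rw [memV, hφ]
    simp only [map_div, hs]
    rw [div_mul_div_comm, div_mul_div_comm, div_eq_one]
    ac_rfl
  have hνF : ν.range ≤ φ.ker := by
    rintro _ ⟨x, rfl⟩
    rw [memF, hνs]
  have hV1 : ν.ker.map φ ≤ φ.range := Subgroup.map_le_range _ _
  have hV2 : ν.ker.map φ ≤ ν.ker := hV1.trans hφV
  have hinj : ∀ x ∈ ν.ker, φ x = 1 → x = 1 := by
    intro x hx h
    have h1 : s x = x := (memF x).1 h
    apply htf x hx
    have := (memV x).1 hx
    rw [h1, h1] at this
    rw [← this, pow_succ, pow_two]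
  -- On the kernel of ν one has 1 + s + s² = 0 additively, so (s - 1)² = -3s, and -s is an
  -- automorphism of that kernel.
  have hφφ : (ν.ker.map φ).map φ = ν.ker.map (powMonoidHom 3) := by
    have key : ∀ x ∈ ν.ker, φ (φ x) = (s x)⁻¹ ^ 3 := by
      intro x hx
      have h := (memV x).1 hx
      have h2 : s (s x) = (x * s x)⁻¹ := by rw [eq_inv_iff_mul_eq_one, mul_comm]; exact h
      rw [hφ (φ x), hφ x, map_div, h2]
      simp only [div_eq_mul_inv, mul_inv, inv_inv, pow_succ, pow_zero, one_mul]
      rw [show x⁻¹ * (s x)⁻¹ * (s x)⁻¹ * ((s x)⁻¹ * x) = x⁻¹ * x * ((s x)⁻¹ * (s x)⁻¹ * (s x)⁻¹) by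
        ac_rfl, inv_mul_cancel, one_mul]
    have hsV : ∀ x ∈ ν.ker, s x ∈ ν.ker := by
      intro x hx
      rw [memV] at hx ⊢
      rw [hs, ← hx]; ac_rfl
    ext y
    simp only [Subgroup.mem_map, powMonoidHom_apply, exists_exists_and_eq_and]
    constructor
    · rintro ⟨x, hx, rfl⟩
      exact ⟨(s x)⁻¹, inv_mem (hsV x hx), (key x hx).symm⟩
    · rintro ⟨x, hx, rfl⟩
      refine ⟨(s (s x))⁻¹, inv_mem (hsV _ (hsV x hx)), ?_⟩
      rw [key _ (inv_mem (hsV _ (hsV x hx))), map_inv, hs, inv_inv]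
  have hkerV : ν.ker ⊓ φ.ker = ⊥ := by
    rw [eq_bot_iff]
    rintro x ⟨hx, hx'⟩
    exact hinj x hx hx'
  -- φ is injective on ker ν, so it preserves indices there. With `hφφ` this makes [ker ν : (ker
  -- ν)³] the square of [ker ν : φ(ker ν)].
  have h1 : ((ν.ker.map φ).map φ).relIndex (ν.ker.map φ) = (ν.ker.map φ).relIndex ν.ker := by
    rw [← Subgroup.relIndex_comap, Subgroup.comap_map_eq]
    rw [← Subgroup.inf_relIndex_right (ν.ker.map φ ⊔ φ.ker)]
    rw [sup_inf_assoc_of_le _ hV2, inf_comm, hkerV, sup_bot_eq]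
  have h2 := Subgroup.relIndex_mul_relIndex _ _ _ (Subgroup.map_mono (f := φ) hV2) hV2
  rw [h1, hφφ] at h2
  have h3 := Subgroup.relIndex_mul_relIndex _ _ _ hV1 hφV
  -- Both sides are the index of ker ν · ker φ in U, because ν is cubing on ker φ.
  have h4 : (ν.ker.map φ).relIndex φ.range = (φ.ker.map (powMonoidHom 3)).relIndex ν.range := by
    have : φ.ker.map (powMonoidHom 3) = φ.ker.map ν := by
      ext y
      simp only [Subgroup.mem_map, powMonoidHom_apply]
      refine exists_congr fun x => and_congr_right fun hx => ?_
      rw [memF] at hx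
      rw [hν, hx, hx, pow_succ, pow_two]
    rw [this, relIndex_map_eq_index_sup, relIndex_map_eq_index_sup, sup_comm]
  have hFν : φ.ker.map (powMonoidHom 3) ≤ ν.range := by
    rintro _ ⟨x, hx, rfl⟩
    refine ⟨x, ?_⟩
    have hx : s x = x := (memF x).1 hx
    rw [hν, hx, hx, powMonoidHom_apply, pow_succ, pow_two]
  have h5 := Subgroup.relIndex_mul_relIndex _ _ _ hFν hνF
  rw [h4] at h3
  set b := (φ.ker.map (powMonoidHom 3)).relIndex ν.range
  set a := (ν.ker.map φ).relIndex ν.ker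
  set g := φ.range.relIndex ν.ker
  set e := ν.range.relIndex φ.ker with he
  have ha : 9 ≤ a := by
    by_contra! h
    have : a * a ≤ 8 * 8 := Nat.mul_le_mul (by omega) (by omega)
    omega
  rw [← h5] at hF hF0
  have hb0 : b ≠ 0 := left_ne_zero_of_mul hF0
  have he0 : e ≠ 0 := right_ne_zero_of_mul hF0
  have hb3 : b ≤ 3 := le_trans (Nat.le_mul_of_pos_right b (Nat.pos_of_ne_zero he0)) hF
  -- b · g = a ≥ 9 with b, g ≤ 3 leaves only b = g = 3; then b · e ≤ 3 forces e = 1.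
  have hg3 : g = 3 := by
    by_contra hg
    have : b * g ≤ 3 * 2 := Nat.mul_le_mul hb3 (by omega)
    omega
  have hb : b = 3 := by rw [hg3] at h3; omega
  have he1 : e = 1 := by rw [hb] at hF; omega
  exact ⟨le_antisymm hνF (Subgroup.relIndex_eq_one.1 he1), hg3⟩

/-- The cosets of 1, w, w² exhaust V modulo H. Nonvanishing is recorded because an infinite index
has the value 0. -/
theorem relIndex_le_three {G : Type*} [CommGroup G] (H V : Subgroup G) (w : G) (hw : w ∈ V)
    (h3 : w ^ 3 ∈ H) (h : ∀ v ∈ V, ∃ k : ℤ, v * w ^ k ∈ H) :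
    H.relIndex V ≤ 3 ∧ H.relIndex V ≠ 0 := by
  have hsurj : Function.Surjective
      (fun i : Fin 3 => (QuotientGroup.mk (⟨w, hw⟩ ^ (i : ℕ)) : V ⧸ H.subgroupOf V)) := by
    intro x
    obtain ⟨⟨v, hv⟩, rfl⟩ := QuotientGroup.mk_surjective x
    obtain ⟨k, hk⟩ := h v hv
    have hm : 0 ≤ (-k) % 3 := Int.emod_nonneg _ (by norm_num)
    have hm' : (-k) % 3 < 3 := Int.emod_lt_of_pos _ (by norm_num)
    refine ⟨⟨((-k) % 3).toNat, by omega⟩, ?_⟩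
    rw [QuotientGroup.eq, Subgroup.mem_subgroupOf]
    push_cast
    rw [← zpow_natCast, Int.toNat_of_nonneg hm, ← zpow_neg]
    have : w ^ (-((-k) % 3)) * v = v * w ^ k * (w ^ 3) ^ ((-k) / 3) := by
      rw [← zpow_natCast w 3, ← zpow_mul, mul_assoc, ← zpow_add, mul_comm]
      congr 2
      have := Int.emod_add_mul_ediv (-k) 3
      push_cast
      omega
    rw [this]
    exact mul_mem hk (zpow_mem h3 _)
  have hfin : Finite (V ⧸ H.subgroupOf V) := Finite.of_surjective _ hsurj
  refine ⟨?_, (Subgroup.index_ne_zero_of_finite (H := H.subgroupOf V))⟩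
  have := Nat.card_le_card_of_surjective _ hsurj
  simpa [Subgroup.relIndex, Subgroup.index] using this

end HerbrandIndex

/-! ### Computing 3-ranks. -/

section RankThree

theorem index_range_pow_three (G : Type*) [CommGroup G] [Module.Free ℤ (Additive G)]
    [Module.Finite ℤ (Additive G)] :
    (powMonoidHom 3 : G →* G).range.index = 3 ^ Module.finrank ℤ (Additive G) := by
  rw [← ModN.natCard_eq (Additive G) 3, ← Subgroup.index_toAddSubgroup]
  have hrange : (LinearMap.range (LinearMap.lsmul ℤ (Additive G) (3 : ℕ))).toAddSubgroup =
      (powMonoidHom 3 : G →* G).range.toAddSubgroup := by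
    ext x
    constructor
    · rintro ⟨y, hy⟩
      exact ⟨y.toMul, congrArg Additive.toMul ((natCast_zsmul y 3).symm.trans hy)⟩
    · rintro ⟨y, hy⟩
      exact ⟨Additive.ofMul y, (natCast_zsmul _ 3).trans (congrArg Additive.ofMul hy)⟩
  rw [← hrange]
  rfl

variable {G : Type*} [CommGroup G]

theorem rankThree_eq_zero (h : ∀ g : G, ∃ x, x ^ 3 = g) : rankThree G = 0 := by
  have : Subsingleton (ModN (Additive G) 3) := by
    refine subsingleton_of_forall_eq 0 fun x => ?_
    obtain ⟨g, rfl⟩ := Submodule.mkQ_surjective _ x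
    obtain ⟨y, hy⟩ := h g.toMul
    rw [Submodule.mkQ_apply, Submodule.Quotient.mk_eq_zero]
    refine ⟨Additive.ofMul y, ?_⟩
    simp only [LinearMap.lsmul_apply]
    exact (natCast_zsmul _ 3).trans (congrArg Additive.ofMul hy)
  exact rank_subsingleton' _ _

theorem mkQ_eq_zero_iff (g : G) :
    (LinearMap.range (LinearMap.lsmul ℤ (Additive G) (3 : ℕ))).mkQ (Additive.ofMul g) = 0 ↔
      ∃ x, x ^ 3 = g := by
  rw [Submodule.mkQ_apply, Submodule.Quotient.mk_eq_zero]
  constructor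
  · rintro ⟨y, hy⟩
    exact ⟨y.toMul, congrArg Additive.toMul ((natCast_zsmul y 3).symm.trans hy)⟩
  · rintro ⟨y, hy⟩
    exact ⟨Additive.ofMul y, (natCast_zsmul _ 3).trans (congrArg Additive.ofMul hy)⟩

theorem rankThree_eq_one (h3 : ∀ g : G, g ^ 3 = 1) (g₀ : G) (h0 : g₀ ≠ 1)
    (h : ∀ g : G, ∃ k : ℤ, g * g₀ ^ k = 1) : rankThree G = 1 := by
  rw [rankThree, rank_eq_one_iff]
  refine ⟨(LinearMap.range (LinearMap.lsmul ℤ (Additive G) (3 : ℕ))).mkQ (Additive.ofMul g₀),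
    ?_, fun x => ?_⟩
  · rw [Ne, mkQ_eq_zero_iff]
    rintro ⟨x, hx⟩
    exact h0 (hx ▸ h3 x)
  · obtain ⟨g, rfl⟩ := Submodule.mkQ_surjective _ x
    obtain ⟨k, hk⟩ := h g.toMul
    refine ⟨((-k : ℤ) : ZMod 3), ?_⟩
    rw [Int.cast_smul_eq_zsmul, ← map_zsmul]
    congr 1
    have : g.toMul = g₀ ^ (-k) := by rw [zpow_neg]; exact eq_inv_of_mul_eq_one_left hk
    exact congrArg Additive.ofMul this.symm

/-- In a finite abelian group the index of the cubes equals the order of the 3-torsion. Rank one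
thus means 3-torsion of prime order 3, generated by any nontrivial element. -/
theorem exists_mul_zpow_eq_one_of_rankThree_eq_one [Finite G] (hG : rankThree G = 1)
    (g h : G) (hg : g ^ 3 = 1) (hh : h ^ 3 = 1) (h1 : h ≠ 1) : ∃ k : ℤ, g * h ^ k = 1 := by
  have : Fact (Nat.Prime 3) := ⟨Nat.prime_three⟩
  have hfin : Finite (ModN (Additive G) 3) := Finite.of_surjective _ (Submodule.mkQ_surjective _)
  have hfr : Module.finrank (ZMod 3) (ModN (Additive G) 3) = 1 :=
    Module.finrank_eq_of_rank_eq hG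
  have hcard : Nat.card (ModN (Additive G) 3) = 3 := by
    rw [Module.natCard_eq_pow_finrank (K := ZMod 3), hfr, pow_one, Nat.card_zmod]
  let f : G →* G := powMonoidHom 3
  have hrange : (LinearMap.range (LinearMap.lsmul ℤ (Additive G) (3 : ℕ))).toAddSubgroup =
      f.range.toAddSubgroup := by
    ext x
    constructor
    · rintro ⟨y, hy⟩
      exact ⟨y.toMul, congrArg Additive.toMul ((natCast_zsmul y 3).symm.trans hy)⟩
    · rintro ⟨y, hy⟩
      exact ⟨Additive.ofMul y, (natCast_zsmul _ 3).trans (congrArg Additive.ofMul hy)⟩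
  have hidx : f.range.index = 3 := by
    rw [← Subgroup.index_toAddSubgroup, ← hrange]
    exact hcard
  have hker : Nat.card f.ker = 3 := by
    have e1 := f.range.index_mul_card
    have e2 := f.ker.index_mul_card
    rw [Subgroup.index_ker, mul_comm] at e2
    rw [hidx, ← e2] at e1
    exact (Nat.eq_of_mul_eq_mul_right Nat.card_pos e1).symm
  have hk : (⟨h, hh⟩ : f.ker) ≠ 1 := fun e => h1 (congrArg Subtype.val e)
  obtain ⟨k, hk⟩ := Subgroup.mem_zpowers_iff.1
    (mem_zpowers_of_prime_card hker hk (g' := (⟨g, hg⟩ : f.ker)))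
  refine ⟨-k, ?_⟩
  have : h ^ k = g := congrArg Subtype.val hk
  rw [zpow_neg, this, mul_inv_cancel]

end RankThree

/-! ### Ideal groups: classes, extension, conjugation and norm. -/

section Ideals

variable {F E : Type*} [Field F] [Field E] [NumberField F] [NumberField E]

variable (F) in
/-- The principal fractional ideal generated by `x`. -/
abbrev principal : Fˣ →* IdealGroup F := toPrincipalIdeal (𝓞 F) F

theorem mem_principalIdeals {A : IdealGroup F} :
    A ∈ principalIdeals F ↔ ∃ x, principal F x = A := Iff.rfl

theorem exists_principal_mul_mk0 (A : IdealGroup F) :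
    ∃ (x : Fˣ) (I : (Ideal (𝓞 F))⁰), A = principal F x * FractionalIdeal.mk0 F I := by
  obtain ⟨a, J, ha, hJ⟩ := FractionalIdeal.exists_eq_spanSingleton_mul (A : FractionalIdeal (𝓞 F)⁰ F)
  have ha' : algebraMap (𝓞 F) F a ≠ 0 := by
    simpa using ha
  have hJ0 : J ≠ 0 := FractionalIdeal.ideal_factor_ne_zero A.ne_zero hJ
  refine ⟨(Units.mk0 _ ha')⁻¹, ⟨J, mem_nonZeroDivisors_of_ne_zero hJ0⟩, ?_⟩
  ext1
  simp [hJ]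

/-- The class of a fractional ideal. -/
def idealClass (F : Type*) [Field F] [NumberField F] : IdealGroup F →* ClassGroup (𝓞 F) :=
  (ClassGroup.equiv (R := 𝓞 F) F).symm.toMonoidHom.comp (QuotientGroup.mk' (toPrincipalIdeal (𝓞 F) F).range)

theorem idealClass_eq_one_iff {A : IdealGroup F} :
    idealClass F A = 1 ↔ ∃ x, principal F x = A := by
  rw [← mem_principalIdeals, principalIdeals, ← QuotientGroup.eq_one_iff A]
  exact MulEquiv.map_eq_one_iff (ClassGroup.equiv (R := 𝓞 F) F).symm

theorem idealClass_principal (x : Fˣ) : idealClass F (principal F x) = 1 :=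
  idealClass_eq_one_iff.2 ⟨x, rfl⟩

theorem idealClass_mk0 (I : (Ideal (𝓞 F))⁰) :
    idealClass F (FractionalIdeal.mk0 F I) = ClassGroup.mk0 I := by
  rw [idealClass, MonoidHom.comp_apply]
  exact (MulEquiv.symm_apply_eq _).2 (ClassGroup.equiv_mk0 F I).symm

theorem idealClass_surjective : Function.Surjective (idealClass F) := fun c => by
  obtain ⟨I, rfl⟩ := ClassGroup.mk0_surjective c
  exact ⟨_, idealClass_mk0 I⟩

theorem exists_principal_eq_pow_classNumber (A : IdealGroup F) :
    ∃ x, principal F x = A ^ classNumber F := by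
  rw [← idealClass_eq_one_iff, map_pow, classNumber]
  exact pow_card_eq_one

/-- Valuations are integers and determine the ideal. Torsion-freeness is what allows identities
between ideals to be checked on principal ideals only, and cube roots of ideals to be unique. -/
theorem idealGroup_pow_eq_one {A : IdealGroup F} {n : ℕ} (hn : n ≠ 0) (h : A ^ n = 1) : A = 1 := by
  ext1
  rw [← FractionalIdeal.finprod_heightOneSpectrum_factorization' F A.ne_zero]
  rw [Units.val_one, ← finprod_one (α := IsDedekindDomain.HeightOneSpectrum (𝓞 F))]
  refine finprod_congr fun v => ?_
  have h1 := congrArg (fun B : IdealGroup F => FractionalIdeal.count F v (B : FractionalIdeal (𝓞 F)⁰ F)) h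
  simp only [Units.val_pow_eq_pow_val, FractionalIdeal.count_pow, Units.val_one,
    FractionalIdeal.count_one, mul_eq_zero, Nat.cast_eq_zero, hn, false_or] at h1
  rw [h1, zpow_zero]

theorem idealGroup_pow_injective {A B : IdealGroup F} {n : ℕ} (hn : n ≠ 0) (h : A ^ n = B ^ n) :
    A = B := by
  rw [← div_eq_one]
  exact idealGroup_pow_eq_one hn (by rw [div_pow, h, div_self'])

/-- Homomorphisms from the ideal group to a torsion-free group are determined by their values on
principal ideals, because the class number is finite. -/
theorem idealGroup_hom_ext {f g : IdealGroup F →* IdealGroup E}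
    (h : ∀ x, f (principal F x) = g (principal F x)) : f = g := by
  ext1 A
  obtain ⟨x, hx⟩ := exists_principal_eq_pow_classNumber A
  refine idealGroup_pow_injective (n := classNumber F) Fintype.card_ne_zero ?_
  rw [← map_pow, ← map_pow, ← hx, h]

/-! ### Extension and conjugation -/

theorem extendIdeal_principal [Algebra F E] (x : Fˣ) :
    extendIdeal F E (principal F x) = principal E (Units.map (algebraMap F E).toMonoidHom x) := by
  ext1
  simp only [extendIdeal, principal, Units.coe_map, coe_toPrincipalIdeal, MonoidHom.coe_coe,
    RingHom.toMonoidHom_eq_coe]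
  rw [FractionalIdeal.extendedHom_spanSingleton]
  congr 1
  refine congrFun (congrArg DFunLike.coe (?_ : IsFractionRing.map _ = algebraMap F E)) _
  apply IsLocalization.ringHom_ext (𝓞 F)⁰
  ext a
  simp [IsFractionRing.map]
  rfl

theorem extendIdeal_injective [Algebra F E] : Function.Injective (extendIdeal F E) := by
  intro A B h
  ext1
  exact FractionalIdeal.extendedHom_injective (𝓞 F) F E (𝓞 E) (congrArg Units.val h)

theorem extendIdeal_extendIdeal {K : Type*} [Field K] [NumberField K] [Algebra F K] [Algebra K E]
    [Algebra F E] [IsScalarTower F K E] (A : IdealGroup F) :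
    extendIdeal K E (extendIdeal F K A) = extendIdeal F E A := by
  have : (extendIdeal K E).comp (extendIdeal F K) = extendIdeal F E := by
    refine idealGroup_hom_ext fun x => ?_
    rw [MonoidHom.comp_apply, extendIdeal_principal, extendIdeal_principal, extendIdeal_principal]
    congr 1
    ext1
    simp [← IsScalarTower.algebraMap_apply]
  exact DFunLike.congr_fun this A

/-- The action of a field automorphism on fractional ideals. -/
def galIdeal (e : E ≃+* E) : IdealGroup E →* IdealGroup E :=
  Units.map (FractionalIdeal.extendedHom' (A := 𝓞 E) (M := (𝓞 E)⁰) (K := E) E (N := (𝓞 E)⁰)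
    (f := (RingOfIntegers.mapRingEquiv e : 𝓞 E →+* 𝓞 E))
    (nonZeroDivisors_le_comap_nonZeroDivisors_of_injective _
      (RingOfIntegers.mapRingEquiv e).injective)).toMonoidHom

theorem galIdeal_principal (e : E ≃+* E) (x : Eˣ) :
    galIdeal e (principal E x) = principal E (Units.map e.toMonoidHom x) := by
  ext1
  simp only [galIdeal, principal, Units.coe_map, coe_toPrincipalIdeal, MonoidHom.coe_coe,
    RingHom.toMonoidHom_eq_coe, FractionalIdeal.extendedHom'_apply,
    FractionalIdeal.extended_spanSingleton]
  congr 1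
  refine congrFun (congrArg DFunLike.coe (?_ : IsLocalization.map E _ _ = (e : E →+* E))) _
  apply IsLocalization.ringHom_ext (𝓞 E)⁰
  ext a
  simp

theorem galIdeal_mk0 (e : E ≃+* E) (I : (Ideal (𝓞 E))⁰) :
    (galIdeal e (FractionalIdeal.mk0 E I) : FractionalIdeal (𝓞 E)⁰ E) =
      (I.1.map (RingOfIntegers.mapRingEquiv e : 𝓞 E →+* 𝓞 E) : Ideal (𝓞 E)) := by
  simp only [galIdeal, Units.coe_map, MonoidHom.coe_coe, RingHom.toMonoidHom_eq_coe,
    FractionalIdeal.extendedHom'_apply, FractionalIdeal.coe_mk0,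
    FractionalIdeal.extended_coeIdeal_eq_map]

theorem galIdeal_extendIdeal [Algebra F E] (e : E ≃+* E) (e' : F ≃+* F)
    (h : ∀ x, e (algebraMap F E x) = algebraMap F E (e' x)) (A : IdealGroup F) :
    galIdeal e (extendIdeal F E A) = extendIdeal F E (galIdeal e' A) := by
  have : (galIdeal e).comp (extendIdeal F E) = (extendIdeal F E).comp (galIdeal e') := by
    refine idealGroup_hom_ext fun x => ?_
    rw [MonoidHom.comp_apply, MonoidHom.comp_apply, extendIdeal_principal, galIdeal_principal,
      galIdeal_principal, extendIdeal_principal]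
    congr 1
    ext1
    exact h x
  exact DFunLike.congr_fun this A

theorem galIdeal_refl (A : IdealGroup E) : galIdeal (RingEquiv.refl E) A = A := by
  have : galIdeal (RingEquiv.refl E) = MonoidHom.id _ := by
    refine idealGroup_hom_ext fun x => ?_
    rw [galIdeal_principal]
    rfl
  rw [this, MonoidHom.id_apply]

/-! ### The norm -/

theorem idealNorm_mk0 [Algebra F E] (I : (Ideal (𝓞 E))⁰) :
    (idealNorm F E (FractionalIdeal.mk0 E I) : FractionalIdeal (𝓞 F)⁰ F) =
      (Ideal.relNorm (𝓞 F) I.1 : Ideal (𝓞 F)) := by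
  have h := fractional_num_den E (I.1 : FractionalIdeal (𝓞 E)⁰ E)
  rw [← FractionalIdeal.coeIdeal_mul, FractionalIdeal.coeIdeal_inj] at h
  change ((Ideal.relNorm (𝓞 F) (FractionalIdeal.num (I.1 : FractionalIdeal (𝓞 E)⁰ E)) :
      FractionalIdeal (𝓞 F)⁰ F) / (Ideal.relNorm (𝓞 F) (Ideal.span
        {((I.1 : FractionalIdeal (𝓞 E)⁰ E).den : 𝓞 E)}) : FractionalIdeal (𝓞 F)⁰ F)) = _
  rw [← h, map_mul, FractionalIdeal.coeIdeal_mul, mul_div_cancel_left₀]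
  rw [Ne, FractionalIdeal.coeIdeal_eq_zero, Ideal.relNorm_eq_bot_iff, Ideal.span_singleton_eq_bot]
  exact nonZeroDivisors.coe_ne_zero _

theorem idealNorm_principal [Algebra F E] (x : Eˣ) :
    idealNorm F E (principal E x) = principal F (Units.map (Algebra.norm F) x) := by
  have key : ∀ (a : 𝓞 E) (ha : (algebraMap (𝓞 E) E a) ≠ 0),
      idealNorm F E (principal E (Units.mk0 _ ha)) =
        principal F (Units.map (Algebra.norm F) (Units.mk0 _ ha)) := by
    intro a ha
    have ha' : Ideal.span {a} ∈ (Ideal (𝓞 E))⁰ :=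
      mem_nonZeroDivisors_of_ne_zero (by simpa using ha)
    have h1 : principal E (Units.mk0 _ ha) = FractionalIdeal.mk0 E ⟨_, ha'⟩ := by
      ext1
      simp
    rw [h1]
    ext1
    rw [idealNorm_mk0, Ideal.relNorm_singleton]
    simp only [FractionalIdeal.coeIdeal_span_singleton, coe_toPrincipalIdeal, Units.coe_map,
      Units.val_mk0]
    congr 1
    exact Algebra.algebraMap_intNorm (A := 𝓞 F) (K := F) (L := E) (B := 𝓞 E) a
  obtain ⟨a, b, hb, hx⟩ := IsFractionRing.div_surjective (A := 𝓞 E) (x : E)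
  have hb' : algebraMap (𝓞 E) E b ≠ 0 := by simpa using nonZeroDivisors.ne_zero hb
  have ha' : algebraMap (𝓞 E) E a ≠ 0 := by
    intro h
    rw [h, zero_div] at hx
    exact x.ne_zero hx.symm
  have : x = Units.mk0 _ ha' / Units.mk0 _ hb' := by
    ext1
    simp [hx]
  rw [this, map_div, map_div, key, key, ← map_div, ← map_div]

/-- For a quadratic Galois extension, the extension of the norm of an ideal is the product of the
ideal with its conjugate. -/
theorem extendIdeal_idealNorm [Algebra F E] (e : E ≃+* E)
    (he : ∀ x, algebraMap F E (Algebra.norm F x) = x * e x) (A : IdealGroup E) :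
    extendIdeal F E (idealNorm F E A) = A * galIdeal e A := by
  have : (extendIdeal F E).comp (idealNorm F E) = MonoidHom.id _ * galIdeal e := by
    refine idealGroup_hom_ext fun x => ?_
    rw [MonoidHom.comp_apply, MonoidHom.mul_apply, MonoidHom.id_apply, galIdeal_principal,
      idealNorm_principal, extendIdeal_principal, ← map_mul]
    congr 1
    ext1
    exact he x
  exact DFunLike.congr_fun this A

theorem extendedHom_idealClass [Algebra F E] (A : IdealGroup F) :
    ClassGroup.extendedHom (𝓞 F) (𝓞 E) (idealClass F A) = idealClass E (extendIdeal F E A) := by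
  obtain ⟨x, I, rfl⟩ := exists_principal_mul_mk0 A
  simp only [map_mul, extendIdeal_principal, idealClass_principal, one_mul, idealClass_mk0]
  rw [ClassGroup.extendedHom_mk0, ← idealClass_mk0]
  congr 1
  ext1
  exact (FractionalIdeal.extendedHom_coeIdeal_eq_map E (𝓞 E) I.1).symm

end Ideals

/-! ### Valuations of fractional ideals. -/

section Counts

variable {F E : Type*} [Field F] [Field E] [NumberField F] [NumberField E]

theorem count_mk0_eq_emultiplicity (v : HeightOneSpectrum (𝓞 F)) (I : (Ideal (𝓞 F))⁰) :
    ∃ n : ℕ, FractionalIdeal.count F v (FractionalIdeal.mk0 F I : FractionalIdeal (𝓞 F)⁰ F) = n ∧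
      emultiplicity v.asIdeal I.1 = n := by
  classical
  have hI : I.1 ≠ 0 := nonZeroDivisors.ne_zero I.2
  refine ⟨_, FractionalIdeal.count_coe F v hI, ?_⟩
  refine ENat.eq_of_forall_natCast_le_iff fun m => ?_
  rw [← pow_dvd_iff_le_emultiplicity, Nat.cast_le,
    ← Associates.prime_pow_dvd_iff_le (Associates.mk_ne_zero.2 hI) v.associates_irreducible,
    ← Associates.mk_pow, Associates.mk_le_mk_iff_dvd]

theorem count_mul_unit (v : HeightOneSpectrum (𝓞 F)) (A B : IdealGroup F) :
    FractionalIdeal.count F v ((A * B : IdealGroup F) : FractionalIdeal (𝓞 F)⁰ F) =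
      FractionalIdeal.count F v (A : FractionalIdeal (𝓞 F)⁰ F) +
      FractionalIdeal.count F v (B : FractionalIdeal (𝓞 F)⁰ F) := by
  rw [Units.val_mul, FractionalIdeal.count_mul F v A.ne_zero B.ne_zero]

/-- The multiplicity of a prime in a fractional ideal, as a homomorphism. -/
def countHom (v : HeightOneSpectrum (𝓞 F)) : IdealGroup F →* Multiplicative ℤ where
  toFun A := Multiplicative.ofAdd (FractionalIdeal.count F v (A : FractionalIdeal (𝓞 F)⁰ F))
  map_one' := by rw [Units.val_one, FractionalIdeal.count_one]; rfl
  map_mul' A B := by rw [count_mul_unit, ofAdd_add]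

theorem toAdd_countHom (v : HeightOneSpectrum (𝓞 F)) (A : IdealGroup F) :
    (countHom v A).toAdd = FractionalIdeal.count F v (A : FractionalIdeal (𝓞 F)⁰ F) := rfl

/-- Homomorphisms on the ideal group are determined by their values on integral ideals. -/
theorem idealGroup_hom_ext_mk0 {M : Type*} [CommGroup M] {f g : IdealGroup F →* M}
    (h : ∀ I, f (FractionalIdeal.mk0 F I) = g (FractionalIdeal.mk0 F I)) : f = g := by
  ext1 A
  obtain ⟨x, I, rfl⟩ := exists_principal_mul_mk0 A
  obtain ⟨a, b, hb, hx⟩ := IsFractionRing.div_surjective (A := 𝓞 F) (x : F)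
  have hb0 : b ≠ 0 := nonZeroDivisors.ne_zero hb
  have hb' : algebraMap (𝓞 F) F b ≠ 0 := by simpa using hb0
  have ha0 : a ≠ 0 := by
    rintro rfl
    rw [map_zero, zero_div] at hx
    exact x.ne_zero hx.symm
  have hp : ∀ c : 𝓞 F, c ≠ 0 → Ideal.span {c} ∈ (Ideal (𝓞 F))⁰ := fun c hc =>
    mem_nonZeroDivisors_of_ne_zero (by simpa using hc)
  have : principal F x = FractionalIdeal.mk0 F ⟨_, hp a ha0⟩ / FractionalIdeal.mk0 F ⟨_, hp b hb0⟩ := by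
    rw [eq_div_iff_mul_eq']
    ext1
    simp only [Units.val_mul, coe_toPrincipalIdeal, FractionalIdeal.coe_mk0,
      FractionalIdeal.coeIdeal_span_singleton, FractionalIdeal.spanSingleton_mul_spanSingleton,
      ← hx]
    congr 1
    field_simp
  rw [this]
  simp only [map_mul, map_div, h]

theorem count_extendIdeal [Algebra F E] (v : HeightOneSpectrum (𝓞 F)) (w : HeightOneSpectrum (𝓞 E))
    [w.asIdeal.LiesOver v.asIdeal] (A : IdealGroup F) :
    FractionalIdeal.count E w (extendIdeal F E A : FractionalIdeal (𝓞 E)⁰ E) =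
      (v.asIdeal.ramificationIdx' w.asIdeal : ℤ) *
        FractionalIdeal.count F v (A : FractionalIdeal (𝓞 F)⁰ F) := by
  have : (countHom w).comp (extendIdeal F E) =
      (countHom v) ^ (v.asIdeal.ramificationIdx' w.asIdeal) := by
    refine idealGroup_hom_ext_mk0 fun I => ?_
    have h0 : I.1 ≠ ⊥ := nonZeroDivisors.ne_zero I.2
    have hI' : I.1.map (algebraMap (𝓞 F) (𝓞 E)) ∈ (Ideal (𝓞 E))⁰ :=
      mem_nonZeroDivisors_of_ne_zero (Ideal.map_ne_bot_of_ne_bot h0)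
    have h1 : extendIdeal F E (FractionalIdeal.mk0 F I) = FractionalIdeal.mk0 E ⟨_, hI'⟩ := by
      ext1
      exact FractionalIdeal.extendedHom_coeIdeal_eq_map E (𝓞 E) I.1
    rw [MonoidHom.comp_apply, h1, MonoidHom.pow_apply]
    obtain ⟨n, hn, hn'⟩ := count_mk0_eq_emultiplicity v I
    obtain ⟨m, hm, hm'⟩ := count_mk0_eq_emultiplicity w ⟨_, hI'⟩
    have := Ideal.IsDedekindDomain.emultiplicity_map_eq_ramificationIdx'_mul h0 v.irreducible
      w.irreducible w.ne_bot
    rw [hm', hn'] at this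
    apply Multiplicative.toAdd.injective
    rw [toAdd_pow, toAdd_countHom, toAdd_countHom, hm, hn, nsmul_eq_mul]
    exact_mod_cast this
  have h := congrArg Multiplicative.toAdd (DFunLike.congr_fun this A)
  rw [MonoidHom.comp_apply, MonoidHom.pow_apply, toAdd_pow, toAdd_countHom, toAdd_countHom,
    nsmul_eq_mul] at h
  exact h

theorem emultiplicity_map_ringEquiv {R S : Type*} [CommRing R] [IsDedekindDomain R] [CommRing S]
    [IsDedekindDomain S] (e : R ≃+* S) (I J : Ideal R) :
    emultiplicity (I.map (e : R →+* S)) (J.map (e : R →+* S)) = emultiplicity I J := by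
  refine emultiplicity_eq_emultiplicity_iff.2 fun n => ?_
  rw [← Ideal.map_pow, Ideal.dvd_iff_le, Ideal.dvd_iff_le, Ideal.map_le_iff_le_comap,
    Ideal.comap_map_of_bijective (e : R →+* S) e.bijective]

theorem count_galIdeal (v : HeightOneSpectrum (𝓞 F)) (e : F ≃+* F)
    (hv : v.asIdeal.map (RingOfIntegers.mapRingEquiv e : 𝓞 F →+* 𝓞 F) = v.asIdeal)
    (A : IdealGroup F) :
    FractionalIdeal.count F v (galIdeal e A : FractionalIdeal (𝓞 F)⁰ F) =
      FractionalIdeal.count F v (A : FractionalIdeal (𝓞 F)⁰ F) := by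
  have : (countHom v).comp (galIdeal e) = countHom v := by
    refine idealGroup_hom_ext_mk0 fun I => ?_
    have h0 : I.1 ≠ ⊥ := nonZeroDivisors.ne_zero I.2
    have hI' : I.1.map (RingOfIntegers.mapRingEquiv e : 𝓞 F →+* 𝓞 F) ∈ (Ideal (𝓞 F))⁰ := by
      refine mem_nonZeroDivisors_of_ne_zero ?_
      exact fun h => h0 ((Ideal.map_eq_bot_iff_of_injective
        (f := (RingOfIntegers.mapRingEquiv e : 𝓞 F →+* 𝓞 F))
        (RingOfIntegers.mapRingEquiv e).injective).1 h)
    have h1 : galIdeal e (FractionalIdeal.mk0 F I) = FractionalIdeal.mk0 F ⟨_, hI'⟩ := by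
      ext1
      rw [galIdeal_mk0]
      rfl
    rw [MonoidHom.comp_apply, h1]
    obtain ⟨n, hn, hn'⟩ := count_mk0_eq_emultiplicity v I
    obtain ⟨m, hm, hm'⟩ := count_mk0_eq_emultiplicity v ⟨_, hI'⟩
    have := emultiplicity_map_ringEquiv (RingOfIntegers.mapRingEquiv e) v.asIdeal I.1
    rw [hn'] at this
    rw [hv] at this
    rw [this] at hm'
    apply Multiplicative.toAdd.injective
    rw [toAdd_countHom, toAdd_countHom, hm, hn]
    exact_mod_cast hm'.symm
  exact congrArg Multiplicative.toAdd (DFunLike.congr_fun this A)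

theorem idealGroup_ext_count {A B : IdealGroup F}
    (h : ∀ v, FractionalIdeal.count F v (A : FractionalIdeal (𝓞 F)⁰ F) =
      FractionalIdeal.count F v (B : FractionalIdeal (𝓞 F)⁰ F)) : A = B := by
  ext1
  rw [← FractionalIdeal.finprod_heightOneSpectrum_factorization' F A.ne_zero,
    ← FractionalIdeal.finprod_heightOneSpectrum_factorization' F B.ne_zero]
  exact finprod_congr fun v => by rw [h]

theorem exists_pow_eq_of_dvd_count {n : ℕ} (A : IdealGroup F)
    (h : ∀ v, (n : ℤ) ∣ FractionalIdeal.count F v (A : FractionalIdeal (𝓞 F)⁰ F)) :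
    ∃ B : IdealGroup F, B ^ n = A := by
  choose k hk using h
  rcases eq_or_ne n 0 with rfl | hn
  -- For n = 0 divisibility says that all valuations vanish, so A = 1.
  · refine ⟨1, idealGroup_ext_count fun v => ?_⟩
    rw [pow_zero, Units.val_one, FractionalIdeal.count_one, hk]
    simp
  have hfin := FractionalIdeal.finite_factors (A : FractionalIdeal (𝓞 F)⁰ F)
  have hk0 : ∀ v, FractionalIdeal.count F v (A : FractionalIdeal (𝓞 F)⁰ F) = 0 → k v = 0 := by
    intro v hv
    rw [hk] at hv
    simpa [hn] using hv
  let f : HeightOneSpectrum (𝓞 F) → IdealGroup F := fun v =>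
    FractionalIdeal.mk0 F ⟨v.asIdeal, mem_nonZeroDivisors_of_ne_zero v.ne_bot⟩ ^ k v
  have hf : f.HasFiniteMulSupport := by
    refine Set.Finite.subset hfin fun v hv h => hv ?_
    simp only [f, hk0 v h, zpow_zero]
  have hco : ∀ v, (f v : FractionalIdeal (𝓞 F)⁰ F) =
      (v.asIdeal : FractionalIdeal (𝓞 F)⁰ F) ^ k v := fun v => by
    simp [f]
  refine ⟨∏ᶠ v, f v, ?_⟩
  rw [finprod_pow hf]
  ext1
  rw [← FractionalIdeal.finprod_heightOneSpectrum_factorization' F A.ne_zero]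
  have hf' : (fun v => f v ^ n).HasFiniteMulSupport := by
    refine Set.Finite.subset hf fun v hv h => hv ?_
    simp only [h, one_pow]
  rw [← Units.coeHom_apply, (Units.coeHom _).map_finprod hf']
  refine finprod_congr fun v => ?_
  rw [Units.coeHom_apply, Units.val_pow_eq_pow_val, hco, hk v, mul_comm, zpow_mul, zpow_natCast]

end Counts

/-! ### Galois theory of cyclic cubic extensions. -/

section CyclicCubic

variable {K N : Type*} [Field K] [Field N] [Algebra K N]

theorem orderOf_generator [FiniteDimensional K N] [IsGalois K N] (h3 : Module.finrank K N = 3)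
    (σ : N ≃ₐ[K] N) (hσ : ∀ x, x ∈ Subgroup.zpowers σ) : orderOf σ = 3 := by
  rw [orderOf_eq_card_of_forall_mem_zpowers hσ, IsGalois.card_aut_eq_finrank, h3]

theorem apply_apply_apply_of_generator [FiniteDimensional K N] [IsGalois K N]
    (h3 : Module.finrank K N = 3) (σ : N ≃ₐ[K] N) (hσ : ∀ x, x ∈ Subgroup.zpowers σ) (x : N) :
    σ (σ (σ x)) = x := by
  have h := pow_orderOf_eq_one σ
  rw [orderOf_generator h3 σ hσ] at h
  exact DFunLike.congr_fun h x

theorem algebraMap_norm_of_generator [FiniteDimensional K N] [IsGalois K N]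
    (h3 : Module.finrank K N = 3) (σ : N ≃ₐ[K] N) (hσ : ∀ x, x ∈ Subgroup.zpowers σ) (x : N) :
    algebraMap K N (Algebra.norm K x) = x * σ x * σ (σ x) := by
  classical
  have ho := orderOf_generator h3 σ hσ
  rw [Algebra.norm_eq_prod_automorphisms, ← IsCyclic.image_range_orderOf hσ,
    Finset.prod_image, ho]
  · simp [Finset.prod_range_succ]
  · intro a ha b hb hab
    exact pow_injOn_Iio_orderOf (by simpa using ha) (by simpa using hb) hab

/-- Hilbert's Theorem 90 for a cyclic cubic extension. -/
theorem exists_apply_eq_mul [FiniteDimensional K N] [IsGalois K N]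
    (h3 : Module.finrank K N = 3) (σ : N ≃ₐ[K] N) (hσ : ∀ x, x ∈ Subgroup.zpowers σ) (v : N)
    (hv : v * σ v * σ (σ v) = 1) : ∃ y : N, y ≠ 0 ∧ σ y = v * y := by
  have ho := orderOf_generator h3 σ hσ
  have hs3 := apply_apply_apply_of_generator h3 σ hσ
  have hinj : Function.Injective
      (fun i : Fin 3 => (((σ ^ (i : ℕ) : N ≃ₐ[K] N) : N →+* N) : N →* N)) := by
    intro i j hij
    have : σ ^ (i : ℕ) = σ ^ (j : ℕ) := by
      ext x
      exact DFunLike.congr_fun hij x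
    exact Fin.ext (pow_injOn_Iio_orderOf (by rw [ho]; exact i.2) (by rw [ho]; exact j.2) this)
  have hli := (linearIndependent_monoidHom N N).comp _ hinj
  rw [Fintype.linearIndependent_iff] at hli
  -- A resolvent of v: applying σ multiplies it by v because v has norm 1. Independence of 1, σ, σ²
  -- makes it nonzero for some θ, as the coefficient of σ² is 1.
  obtain ⟨θ, hθ⟩ : ∃ θ : N, σ v * σ (σ v) * θ + σ (σ v) * σ θ + σ (σ θ) ≠ 0 := by
    by_contra! hcon
    have := hli ![σ v * σ (σ v), σ (σ v), 1] (by
      ext θ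
      have h := hcon θ
      simp only [Function.comp_apply, Fin.sum_univ_three, Pi.add_apply, Pi.smul_apply, smul_eq_mul]
      simpa [pow_two] using h) 2
    simp at this
  refine ⟨_, hθ, ?_⟩
  simp only [map_add, map_mul, hs3]
  linear_combination -θ * hv

theorem mem_range_algebraMap_of_fixed [FiniteDimensional K N] [IsGalois K N]
    (σ : N ≃ₐ[K] N) (hσ : ∀ x, x ∈ Subgroup.zpowers σ) (x : N) (hx : σ x = x) :
    ∃ y, algebraMap K N y = x := by
  refine (IsGalois.mem_range_algebraMap_iff_fixed x).2 fun f => ?_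
  have h : Subgroup.zpowers σ ≤ MulAction.stabilizer (N ≃ₐ[K] N) x := by
    rw [Subgroup.zpowers_le]
    exact hx
  exact h (hσ f)

end CyclicCubic

/-! ### Units of totally real fields. -/

section RealUnits

variable {F : Type*} [Field F] [NumberField F]

/-- A real embedding of a totally real field. -/
def realEmbedding (F : Type*) [Field F] [NumberField F] [IsTotallyReal F] : F →+* ℝ :=
  InfinitePlace.embedding_of_isReal (IsTotallyReal.isReal (Classical.arbitrary (InfinitePlace F)))

theorem eq_one_of_pow_three [IsTotallyReal F] (x : F) (h : x ^ 3 = 1) : x = 1 := by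
  have h1 : realEmbedding F x ^ 3 = 1 ^ 3 := by rw [← map_pow, h, map_one, one_pow]
  have : realEmbedding F x = 1 := (Odd.strictMono_pow (by decide : Odd 3)).injective h1
  rw [← map_one (realEmbedding F)] at this
  exact (realEmbedding F).injective this

/-- A root of unity with a real embedding is ±1. In this form the statement shows that torsion is
absorbed by cubes, so a fundamental unit alone generates the units of K modulo cubes. -/
theorem torsion_pow_three [IsTotallyReal F] {ζ : (𝓞 F)ˣ} (h : ζ ∈ Units.torsion F) : ζ ^ 3 = ζ := by
  obtain ⟨n, hn, h⟩ := isOfFinOrder_iff_pow_eq_one.1 h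
  have h1 : (realEmbedding F (ζ : F)) ^ n = 1 := by
    rw [← map_pow, ← Units.coe_pow, h]
    simp
  have h2 : |realEmbedding F (ζ : F)| = 1 := by
    rw [← pow_eq_one_iff_of_nonneg (abs_nonneg _) hn.ne', ← abs_pow, h1, abs_one]
  have h3 : realEmbedding F (ζ : F) ^ 2 = 1 := by rw [← sq_abs, h2, one_pow]
  have h4 : (ζ : F) ^ 2 = 1 := by
    apply (realEmbedding F).injective
    rw [map_pow, h3, map_one]
  refine Units.ext (RingOfIntegers.coe_injective ?_)
  rw [Units.val_pow_eq_pow_val, map_pow, pow_succ, h4, one_mul]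

theorem rank_eq_of_isTotallyReal [IsTotallyReal F] : Units.rank F = Module.finrank ℚ F - 1 := by
  have h1 := InfinitePlace.card_add_two_mul_card_eq_rank F
  have h2 := InfinitePlace.card_eq_nrRealPlaces_add_nrComplexPlaces F
  rw [IsTotallyReal.nrComplexPlaces_eq_zero] at h1 h2
  rw [Units.rank, h2, ← h1]

theorem exists_isFundamentalUnit [IsTotallyReal F] (h : Module.finrank ℚ F = 2) :
    ∃ η : (𝓞 F)ˣ, IsFundamentalUnit F η := by
  have hr : Units.rank F = 1 := by rw [rank_eq_of_isTotallyReal, h]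
  have : Unique (Fin (Units.rank F)) := by rw [hr]; infer_instance
  refine ⟨Units.fundSystem F default, ?_⟩
  rw [IsFundamentalUnit, Subgroup.zpowers_eq_closure, ← Units.closure_fundSystem_sup_torsion_eq_top,
    Set.range_unique]

end RealUnits

/-! ### The unit group of N as a Galois module. -/

section UnitGroups

variable {K N : Type*} [Field K] [Field N] [NumberField K] [NumberField N] [Algebra K N]

/-- The action of an automorphism on units. -/
def galUnits (σ : N ≃ₐ[K] N) : (𝓞 N)ˣ →* (𝓞 N)ˣ :=
  Units.map (RingOfIntegers.mapRingEquiv σ.toRingEquiv).toRingHom.toMonoidHom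

set_option linter.unusedSectionVars false in
theorem coe_galUnits (σ : N ≃ₐ[K] N) (u : (𝓞 N)ˣ) : ((galUnits σ u : 𝓞 N) : N) = σ (u : N) := rfl

set_option linter.unusedSectionVars false in
theorem units_ext {u v : (𝓞 N)ˣ} (h : (u : N) = v) : u = v := by
  ext; exact h

/-- The inclusion of unit groups. -/
def extendUnits (K N : Type*) [Field K] [Field N] [NumberField K] [NumberField N] [Algebra K N] :
    (𝓞 K)ˣ →* (𝓞 N)ˣ :=
  Units.map (algebraMap (𝓞 K) (𝓞 N)).toMonoidHom

theorem extendUnits_injective : Function.Injective (extendUnits K N) := fun _ _ h =>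
  units_ext ((algebraMap K N).injective (congrArg (fun u : (𝓞 N)ˣ => (u : N)) h))

theorem exists_extendUnits_eq [IsGalois K N] (σ : N ≃ₐ[K] N)
    (hσ : ∀ x, x ∈ Subgroup.zpowers σ) (u : (𝓞 N)ˣ) (hu : galUnits σ u = u) :
    ∃ y, extendUnits K N y = u := by
  have key : ∀ u : (𝓞 N)ˣ, galUnits σ u = u → ∃ y : 𝓞 K, algebraMap K N y = u := by
    intro u hu
    obtain ⟨y, hy⟩ := mem_range_algebraMap_of_fixed σ hσ (u : N)
      (by rw [← coe_galUnits, hu])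
    have hint : IsIntegral ℤ y := by
      rw [← isIntegral_algebraMap_iff (algebraMap K N).injective, hy]
      exact RingOfIntegers.isIntegral_coe _
    exact ⟨⟨y, hint⟩, hy⟩
  -- Descending both u and its inverse shows that the element found in K is a unit.
  obtain ⟨y, hy⟩ := key u hu
  obtain ⟨z, hz⟩ := key u⁻¹ (by rw [map_inv, hu])
  have hyz : y * z = 1 := by
    apply RingOfIntegers.coe_injective
    apply (algebraMap K N).injective
    rw [map_mul, map_mul, hy, hz]
    simp
  exact ⟨⟨y, z, hyz, by rw [mul_comm, hyz]⟩, units_ext hy⟩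

theorem exists_units_mul_eq_of_principal_eq {x y : Nˣ} (h : principal N x = principal N y) :
    ∃ u : (𝓞 N)ˣ, (u : N) * x = y := by
  have h := congrArg Units.val h
  rw [coe_toPrincipalIdeal, coe_toPrincipalIdeal,
    FractionalIdeal.spanSingleton_eq_spanSingleton] at h
  obtain ⟨u, hu⟩ := h
  exact ⟨u, by rw [← hu, Units.smul_def, Algebra.smul_def]⟩

theorem principal_eq_of_units_mul_eq {x y : Nˣ} (u : (𝓞 N)ˣ) (h : (u : N) * x = y) :
    principal N x = principal N y := by
  ext1
  rw [coe_toPrincipalIdeal, coe_toPrincipalIdeal, FractionalIdeal.spanSingleton_eq_spanSingleton]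
  exact ⟨u, by rw [← h, Units.smul_def, Algebra.smul_def]⟩

/-- The kernel of the norm on units, as a kernel of a linear map. -/
def additiveKerEquiv (K N : Type*) [Field K] [Field N] [NumberField K] [NumberField N]
    [Algebra K N] : Additive (unitNorm K N).ker ≃ₗ[ℤ]
      LinearMap.ker (unitNorm K N).toAdditive.toIntLinearMap :=
  AddEquiv.toIntLinearEquiv
    { toFun := fun x => ⟨Additive.ofMul (x.toMul : (𝓞 N)ˣ), congrArg Additive.ofMul x.toMul.2⟩
      invFun := fun x => Additive.ofMul ⟨x.1.toMul, congrArg Additive.toMul x.2⟩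
      left_inv := fun _ => rfl
      right_inv := fun _ => rfl
      map_add' := fun _ _ => rfl }

/-- By Dirichlet U_N has rank 5 and U_K has rank 1, so the kernel loses at most one. -/
theorem finrank_ker_unitNorm [IsTotallyReal N] [IsTotallyReal K] (hK : Module.finrank ℚ K = 2)
    (hN : Module.finrank ℚ N = 6) :
    4 ≤ Module.finrank ℤ (Additive (unitNorm K N).ker) := by
  rw [(additiveKerEquiv K N).finrank_eq]
  set g : Additive (𝓞 N)ˣ →ₗ[ℤ] Additive (𝓞 K)ˣ := (unitNorm K N).toAdditive.toIntLinearMap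
  have h1 := Submodule.finrank_quotient_add_finrank (LinearMap.ker g)
  have h2 : Module.finrank ℤ (Additive (𝓞 N)ˣ ⧸ LinearMap.ker g) ≤ 1 := by
    rw [g.quotKerEquivRange.finrank_eq]
    refine (Submodule.finrank_le _).trans ?_
    rw [Units.finrank_eq, rank_eq_of_isTotallyReal, hK]
  rw [Units.finrank_eq, rank_eq_of_isTotallyReal, hN] at h1
  omega

theorem eq_one_of_pow_three_units [IsTotallyReal N] (u : (𝓞 N)ˣ) (h : u ^ 3 = 1) : u = 1 := by
  apply units_ext
  have := eq_one_of_pow_three (u : N) (by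
    have := congrArg (fun u : (𝓞 N)ˣ => (u : N)) h
    simpa using this)
  simpa using this

/-- The only possible torsion is -1, whose norm in odd degree is -1; so the kernel is free of rank
at least 4, and 81 = 3⁴. -/
theorem le_index_cubes_ker_unitNorm [IsTotallyReal N] [IsTotallyReal K]
    (hK : Module.finrank ℚ K = 2) (hN : Module.finrank ℚ N = 6) (h3 : Module.finrank K N = 3) :
    81 ≤ ((unitNorm K N).ker.map (powMonoidHom 3)).relIndex (unitNorm K N).ker := by
  have h4 := finrank_ker_unitNorm (K := K) (N := N) hK hN
  have hfin : Module.Finite ℤ (Additive (unitNorm K N).ker) :=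
    Module.Finite.equiv (additiveKerEquiv K N).symm
  have htors : ∀ u ∈ (unitNorm K N).ker, ∀ n : ℕ, 0 < n → u ^ n = 1 → u = 1 := by
    intro u hu n hn hun
    have ht : u ∈ Units.torsion N := isOfFinOrder_iff_pow_eq_one.2 ⟨n, hn, hun⟩
    have h2 : u ^ 2 = 1 := by
      have := torsion_pow_three ht
      rwa [pow_succ, mul_eq_right] at this
    have h2' : (u : N) ^ 2 = 1 := by
      simpa using congrArg (fun u : (𝓞 N)ˣ => (u : N)) h2
    rw [pow_two] at h2'
    rcases mul_self_eq_one_iff.1 h2' with h | h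
    · exact units_ext (by simpa using h)
    · exfalso
      have h5 : Algebra.norm K (u : N) = 1 := congrArg (fun u : (𝓞 K)ˣ => (u : K)) hu
      rw [h, show (-1 : N) = algebraMap K N (-1) by simp, Algebra.norm_algebraMap, h3] at h5
      norm_num at h5
  have hfree : Module.Free ℤ (Additive (unitNorm K N).ker) := by
    have : IsMulTorsionFree (unitNorm K N).ker := by
      refine ⟨fun n hn x y hxy => ?_⟩
      have h := htors (x / y : (unitNorm K N).ker) (SetLike.coe_mem _) n (Nat.pos_of_ne_zero hn) (by
        rw [← Subgroup.coe_pow, div_pow, show x ^ n = y ^ n from hxy, div_self']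
        rfl)
      exact div_eq_one.1 (Subtype.ext h)
    infer_instance
  have h5 := index_range_pow_three (unitNorm K N).ker
  have h6 : ((unitNorm K N).ker.map (powMonoidHom 3)).relIndex (unitNorm K N).ker =
      (powMonoidHom 3 : (unitNorm K N).ker →* (unitNorm K N).ker).range.index := by
    rw [Subgroup.relIndex]
    congr 1
    ext x
    constructor
    · rintro ⟨y, hy, h⟩
      exact ⟨⟨y, hy⟩, Subtype.ext h⟩
    · rintro ⟨y, h⟩
      exact ⟨y, y.2, congrArg Subtype.val h⟩
  rw [h6, h5]
  exact (Nat.pow_le_pow_right (by norm_num : 0 < 3) h4)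

/-- If the quotient of the ambiguous principal ideals by the base principal ideals is generated by
each of its nontrivial elements, then it is nontrivial and every unit of `K` is a norm. -/
theorem unitNorm_surjective [IsTotallyReal N] [IsTotallyReal K] [IsGalois K N]
    (hK : Module.finrank ℚ K = 2) (hN : Module.finrank ℚ N = 6) (h3 : Module.finrank K N = 3)
    (σ : N ≃ₐ[K] N) (hσ : ∀ x, x ∈ Subgroup.zpowers σ)
    (hX : ∀ A ∈ ambiguousPrincipalIdeals K N, ∀ B ∈ ambiguousPrincipalIdeals K N,
      B ∉ basePrincipalIdeals K N → ∃ k : ℤ, A * B ^ k ∈ basePrincipalIdeals K N) :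
    Function.Surjective (unitNorm K N) ∧
      ∃ B ∈ ambiguousPrincipalIdeals K N, B ∉ basePrincipalIdeals K N := by
  set s := galUnits σ with hs
  have hs3 : ∀ x, s (s (s x)) = x := fun x =>
    units_ext (apply_apply_apply_of_generator h3 σ hσ (x : N))
  set φ : (𝓞 N)ˣ →* (𝓞 N)ˣ := s / MonoidHom.id _ with hφ_def
  set ν : (𝓞 N)ˣ →* (𝓞 N)ˣ := (extendUnits K N).comp (unitNorm K N) with hν_def
  have hφ : ∀ x, φ x = s x / x := fun x => rfl
  have hν : ∀ x, ν x = x * s x * s (s x) := fun x =>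
    units_ext (algebraMap_norm_of_generator h3 σ hσ (x : N))
  have hker : ν.ker = (unitNorm K N).ker := by
    ext x
    rw [MonoidHom.mem_ker, MonoidHom.mem_ker, hν_def, MonoidHom.comp_apply,
      map_eq_one_iff _ extendUnits_injective]
  have memF : ∀ x, x ∈ φ.ker ↔ s x = x := fun x => by rw [MonoidHom.mem_ker, hφ, div_eq_one]
  -- Hilbert 90
  have h90 : ∀ v ∈ ν.ker, ∃ β : Nˣ, σ β = (v : N) * β ∧
      principal N β ∈ ambiguousPrincipalIdeals K N := by
    intro v hv
    rw [MonoidHom.mem_ker, hν] at hv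
    have hv' : (v : N) * σ v * σ (σ v) = 1 := congrArg (fun u : (𝓞 N)ˣ => (u : N)) hv
    obtain ⟨y, hy, hy'⟩ := exists_apply_eq_mul h3 σ hσ (v : N) hv'
    refine ⟨Units.mk0 y hy, hy', ?_, ⟨_, rfl⟩⟩
    refine ⟨principal K (Units.map (Algebra.norm K) (Units.mk0 y hy)), ?_⟩
    rw [powMonoidHom_apply, ← map_pow, extendIdeal_principal]
    -- The norm of β is β · vβ · σ(v)vβ, so β³ agrees with an element of K up to the unit v²σ(v).
    refine (principal_eq_of_units_mul_eq (v ^ 2 * s v) ?_).symm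
    have : algebraMap K N (Algebra.norm K y) = _ := algebraMap_norm_of_generator h3 σ hσ y
    rw [hy', map_mul, hy'] at this
    change (v : N) ^ 2 * σ v * y ^ 3 = algebraMap K N (Algebra.norm K y)
    rw [this]
    ring
  -- Injectivity of the Hilbert 90 map: if β = ub with b in K and u a unit, then v = σ(u)/u.
  have hbase : ∀ v : (𝓞 N)ˣ, ∀ β : Nˣ, σ β = (v : N) * β →
      principal N β ∈ basePrincipalIdeals K N → v ∈ φ.range := by
    rintro v β hβ ⟨_, ⟨b, rfl⟩, hb⟩
    rw [extendIdeal_principal] at hb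
    obtain ⟨u, hu⟩ := exists_units_mul_eq_of_principal_eq hb
    refine ⟨u, ?_⟩
    rw [hφ, div_eq_iff_eq_mul]
    apply units_ext
    have hb0 : algebraMap K N b ≠ 0 := by simp
    have hu : (u : N) * algebraMap K N b = β := hu
    rw [← hu, map_mul, AlgEquiv.commutes, ← mul_assoc] at hβ
    exact mul_right_cancel₀ hb0 hβ
  have hφφ : ∀ v ∈ ν.ker, v ^ 3 ∈ φ.range := by
    intro v hv
    rw [MonoidHom.mem_ker, hν] at hv
    -- Additively 3 = -(s - 1)(s + 2) modulo 1 + s + s².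
    refine ⟨(v ^ 2 * s v)⁻¹, ?_⟩
    have hv2 : s (s v) = (v * s v)⁻¹ := by rw [eq_inv_iff_mul_eq_one, mul_comm]; exact hv
    rw [hφ, map_inv, map_mul, map_pow, hv2]
    apply_fun (· * (s v)^2) using mul_left_injective _
    simp only [div_eq_mul_inv, mul_inv, inv_inv]
    rw [show ((s v ^ 2)⁻¹ * (v * s v) * (v ^ 2 * s v)) * s v ^ 2 =
      ((s v ^ 2)⁻¹ * s v ^ 2) * ((v * s v) * (v ^ 2 * s v)) by ac_rfl, inv_mul_cancel, one_mul]
    simp only [pow_succ, pow_zero, one_mul]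
    ac_rfl
  have hV : φ.range.relIndex ν.ker ≤ 3 := by
    by_cases hle : ν.ker ≤ φ.range
    · rw [Subgroup.relIndex_eq_one.2 hle]; norm_num
    obtain ⟨w, hw, hwφ⟩ := Set.not_subset.1 hle
    obtain ⟨βw, hβw, hβw'⟩ := h90 w hw
    refine (relIndex_le_three φ.range ν.ker w hw (hφφ w hw) fun v hv => ?_).1
    obtain ⟨βv, hβv, hβv'⟩ := h90 v hv
    obtain ⟨k, hk⟩ := hX _ hβv' _ hβw' fun h => hwφ (hbase w βw hβw h)
    refine ⟨k, hbase _ (βv * βw ^ k) ?_ ?_⟩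
    · have : ((w ^ k : (𝓞 N)ˣ) : N) = (w : N) ^ k := Units.coe_zpow w k
      simp only [Units.val_mul, Units.val_zpow_eq_zpow_val, map_mul, map_zpow₀, hβv, hβw, mul_zpow]
      rw [this]
      ring
    · rwa [map_mul, map_zpow]
  obtain ⟨η, hη⟩ := exists_isFundamentalUnit hK
  have hF : ∀ u ∈ φ.ker, ∃ k : ℤ, u * extendUnits K N η ^ k ∈ φ.ker.map (powMonoidHom 3) := by
    intro u hu
    obtain ⟨y, rfl⟩ := exists_extendUnits_eq σ hσ u ((memF u).1 hu)
    have hy : y ∈ Subgroup.zpowers η ⊔ Units.torsion K := by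
      rw [show Subgroup.zpowers η ⊔ Units.torsion K = ⊤ from hη]; trivial
    obtain ⟨_, ⟨k, rfl⟩, ζ, hζ, rfl⟩ := Subgroup.mem_sup.1 hy
    refine ⟨-k, extendUnits K N ζ, ?_, ?_⟩
    · exact (memF _).2 (units_ext (AlgEquiv.commutes σ _))
    · rw [powMonoidHom_apply, ← map_pow, torsion_pow_three hζ, ← map_zpow, ← map_mul]
      congr 1
      dsimp only
      rw [zpow_neg, mul_comm, inv_mul_cancel_left]
  have hηF : extendUnits K N η ∈ φ.ker := (memF _).2 (units_ext (AlgEquiv.commutes σ _))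
  have hF3 := relIndex_le_three (φ.ker.map (powMonoidHom 3)) φ.ker _ hηF ⟨_, hηF, rfl⟩ hF
  obtain ⟨h1, h2⟩ := range_norm_eq_fixed s hs3 φ ν hφ hν
    (fun x _ hx => eq_one_of_pow_three_units x hx)
    (by rw [hker]; exact le_index_cubes_ker_unitNorm hK hN h3) hV hF3.1 hF3.2
  constructor
  · intro y
    have : extendUnits K N y ∈ ν.range := by
      rw [h1]
      exact (memF _).2 (units_ext (AlgEquiv.commutes σ _))
    obtain ⟨u, hu⟩ := this
    exact ⟨u, extendUnits_injective hu⟩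
  -- The index is exactly 3, so some w of norm 1 lies outside φ(U_N), and its Hilbert 90 ideal is
  -- nontrivial in X.
  · have hle : ¬ ν.ker ≤ φ.range := fun h => by
      rw [Subgroup.relIndex_eq_one.2 h] at h2
      omega
    obtain ⟨w, hw, hwφ⟩ := Set.not_subset.1 hle
    obtain ⟨β, hβ, hβ'⟩ := h90 w hw
    exact ⟨_, hβ', fun h => hwφ (hbase w β hβ h)⟩

end UnitGroups

/-! ### Ramification groups and the conductor. -/

section Ramification

variable {K N : Type*} [Field K] [Field N] [NumberField K] [NumberField N] [Algebra K N]

set_option linter.unusedSectionVars false in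
theorem exists_liesOver (v : HeightOneSpectrum (𝓞 K)) :
    ∃ w : HeightOneSpectrum (𝓞 N), w.asIdeal.LiesOver v.asIdeal := by
  obtain ⟨P, hP⟩ := v.asIdeal.nonempty_primesOver (S := 𝓞 N)
  have := hP.1
  have := hP.2
  exact ⟨⟨P, hP.1, Ideal.ne_bot_of_liesOver_of_ne_bot v.ne_bot P⟩, hP.2⟩

theorem ramificationIdx_eq_one_of_isUnramifiedExtension (h : IsUnramifiedExtension K N)
    (v : HeightOneSpectrum (𝓞 K)) (w : HeightOneSpectrum (𝓞 N)) [w.asIdeal.LiesOver v.asIdeal] :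
    v.asIdeal.ramificationIdx' w.asIdeal = 1 := by
  have := h w.asIdeal
  rw [Ideal.ramificationIdx'_eq_ramificationIdx _ _ v.ne_bot, Ideal.ramificationIdx_eq_one]

/-- A nontrivial σ moves some integer x, and σx - x lies in only finitely many powers of P by
Krull's intersection theorem. Without finiteness `ncard` would return 0. -/
theorem finite_ramificationGroup_ne_bot (P : Ideal (𝓞 N)) (hP : P ≠ ⊤) :
    {i : ℕ | ramificationGroup K N P i ≠ ⊥}.Finite := by
  have key : ∀ σ : N ≃ₐ[K] N, σ ≠ 1 → {i : ℕ | σ ∈ ramificationGroup K N P i}.Finite := by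
    intro σ hσ
    obtain ⟨x, hx⟩ : ∃ x : 𝓞 N, σ • x - x ≠ 0 := by
      by_contra! h
      refine hσ (AlgEquiv.ext fun y => ?_)
      obtain ⟨a, b, hb, rfl⟩ := IsFractionRing.div_surjective (A := 𝓞 N) y
      have h' : ∀ c : 𝓞 N, σ (c : N) = c := fun c =>
        congrArg (fun c : 𝓞 N => (c : N)) (sub_eq_zero.1 (h c))
      rw [map_div₀, h', h', AlgEquiv.one_apply]
    obtain ⟨n, hn⟩ : ∃ n, σ • x - x ∉ P ^ n := by
      by_contra! h
      have : σ • x - x ∈ ⨅ i : ℕ, P ^ i := by simpa [Ideal.mem_iInf] using h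
      rw [Ideal.iInf_pow_eq_bot_of_isDomain P hP] at this
      exact hx this
    refine (Set.finite_lt_nat n).subset fun i hi => ?_
    by_contra hni
    have hni : n ≤ i := by simpa using hni
    exact hn (Ideal.pow_le_pow_right (by omega : n ≤ i + 1) (hi x))
  refine (Set.Finite.biUnion (Set.toFinite {σ : N ≃ₐ[K] N | σ ≠ 1}) key).subset fun i hi => ?_
  obtain ⟨σ, hσ⟩ := Subgroup.ne_bot_iff_exists_ne_one.1 hi
  have hσ1 : (σ : N ≃ₐ[K] N) ≠ 1 := fun h => hσ (Subtype.ext h)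
  exact Set.mem_biUnion (t := fun σ => {i : ℕ | σ ∈ ramificationGroup K N P i}) hσ1 σ.2

/-- The group G_0 is the inertia group, of order e; so ramification puts i = 0 into the finite set
being counted. -/
theorem conductorExponent_ne_zero [IsGalois K N]
    (v : HeightOneSpectrum (𝓞 K)) (w : HeightOneSpectrum (𝓞 N)) [w.asIdeal.LiesOver v.asIdeal]
    (h : v.asIdeal.ramificationIdx' w.asIdeal ≠ 1) : conductorExponent K N v.asIdeal ≠ 0 := by
  have hfin : {i : ℕ | ∃ P ∈ v.asIdeal.primesOver (𝓞 N), ramificationGroup K N P i ≠ ⊥}.Finite := by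
    have := Set.Finite.biUnion (IsDedekindDomain.primesOver_finite v.asIdeal (𝓞 N))
      (t := fun P => {i : ℕ | ramificationGroup K N P i ≠ ⊥})
      (fun P hP => finite_ramificationGroup_ne_bot P hP.1.ne_top)
    refine this.subset fun i hi => ?_
    obtain ⟨P, hP, hi⟩ := hi
    exact Set.mem_biUnion hP hi
  rw [conductorExponent, Ne, Set.ncard_eq_zero hfin, ← Ne, ← Set.nonempty_iff_ne_empty]
  refine ⟨0, w.asIdeal, ⟨w.isPrime, ‹_›⟩, fun hbot => h ?_⟩
  rw [ramificationGroup, zero_add, pow_one] at hbot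
  have : Finite (𝓞 K ⧸ v.asIdeal) := Ideal.finiteQuotientOfFreeOfNeBot v.asIdeal v.ne_bot
  have hc := Ideal.card_inertia_eq_ramificationIdxIn (G := N ≃ₐ[K] N) v.asIdeal w.asIdeal
  rw [Ideal.ramificationIdxIn_eq_ramificationIdx v.asIdeal w.asIdeal (N ≃ₐ[K] N)] at hc
  rw [Ideal.ramificationIdx'_eq_ramificationIdx _ _ v.ne_bot, ← hc]
  have : w.asIdeal.inertia (N ≃ₐ[K] N) = ⊥ := hbot
  rw [this]
  simp

/-- If the conductor is divisible by a single rational prime which does not split in `K`, then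
`N/K` is ramified at most above one prime, and this prime is stable under all automorphisms. -/
theorem exists_ramified_prime [IsGalois K N] {q : ℕ} (hf : (conductor K N).primeFactors = {q})
    (hq : DoesNotSplit K q) : ∃ v₀ : HeightOneSpectrum (𝓞 K),
      (∀ (v : HeightOneSpectrum (𝓞 K)) (w : HeightOneSpectrum (𝓞 N)),
        w.asIdeal.LiesOver v.asIdeal → v ≠ v₀ → v.asIdeal.ramificationIdx' w.asIdeal = 1) ∧
      ∀ e : K ≃+* K,
        v₀.asIdeal.map (RingOfIntegers.mapRingEquiv e : 𝓞 K →+* 𝓞 K) = v₀.asIdeal := by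
  have hqm : q ∈ (conductor K N).primeFactors := by rw [hf]; simp
  have hqp : q.Prime := Nat.prime_of_mem_primeFactors hqm
  have hf0 : conductor K N ≠ 0 := fun h => by simp [h] at hqm
  obtain ⟨Q, hQ⟩ := Set.ncard_eq_one.1 hq
  have hQm : Q ∈ (Ideal.span {(q : ℤ)}).primesOver (𝓞 K) := by rw [hQ]; rfl
  have hq0 : Ideal.span {(q : ℤ)} ≠ ⊥ := by simpa using hqp.ne_zero
  have := hQm.1
  have := hQm.2
  have hmem : ∀ P : Ideal (𝓞 K), P.IsPrime → (q : 𝓞 K) ∈ P → P = Q := by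
    intro P hP hqP
    have : P ∈ (Ideal.span {(q : ℤ)}).primesOver (𝓞 K) := by
      refine ⟨hP, ⟨?_⟩⟩
      have hmax : (Ideal.span {(q : ℤ)}).IsMaximal :=
        PrincipalIdealRing.isMaximal_of_irreducible (Nat.prime_iff_prime_int.1 hqp).irreducible
      refine hmax.eq_of_le (Ideal.IsPrime.under ℤ P).ne_top ?_
      rw [Ideal.span_singleton_le_iff_mem, Ideal.under_def, Ideal.mem_comap]
      simpa using hqP
    rw [hQ] at this
    exact this
  have hqQ : (q : 𝓞 K) ∈ Q := by
    have : (q : ℤ) ∈ Q.under ℤ := by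
      rw [← Q.over_def (Ideal.span {(q : ℤ)})]
      exact Ideal.mem_span_singleton_self _
    rw [Ideal.under_def, Ideal.mem_comap] at this
    simpa using this
  refine ⟨⟨Q, hQm.1, Ideal.ne_bot_of_liesOver_of_ne_bot hq0 Q⟩, ?_, ?_⟩
  · intro v w hw hv
    by_contra he
    have hexp := conductorExponent_ne_zero v w he
    -- `sInf` of the empty set is 0, so a nonzero conductor is attained and does lie in the
    -- conductor ideal.
    have hcm : ((conductor K N : ℕ) : 𝓞 K) ∈ conductorIdeal K N := by
      have hne : {f : ℕ | 0 < f ∧ (f : 𝓞 K) ∈ conductorIdeal K N}.Nonempty := by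
        rw [Set.nonempty_iff_ne_empty]
        intro h
        apply hf0
        rw [conductor, h, Nat.sInf_empty]
      exact (Nat.sInf_mem hne).2
    have hv1 : ((conductor K N : ℕ) : 𝓞 K) ∈ v.asIdeal :=
      Ideal.pow_le_self hexp ((iInf_le _ v : conductorIdeal K N ≤ _) hcm)
    -- The conductor is a power of q, so the ramified prime v contains q and must be Q.
    rw [← Nat.prod_factorization_pow_eq_self hf0, Nat.prod_factorization_eq_prod_primeFactors, hf,
      Finset.prod_singleton, Nat.cast_pow] at hv1
    exact hv (HeightOneSpectrum.ext (hmem _ v.isPrime (v.isPrime.mem_of_pow_mem _ hv1)))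
  · intro e
    refine hmem _ ?_ ?_
    · exact Ideal.map_isPrime_of_equiv (RingOfIntegers.mapRingEquiv e)
    · have := Ideal.mem_map_of_mem (RingOfIntegers.mapRingEquiv e : 𝓞 K →+* 𝓞 K) hqQ
      simpa using this

end Ramification

/-! ### Ambiguous ideals and capitulation. -/

section Ambiguous

variable {F E : Type*} [Field F] [Field E] [NumberField F] [NumberField E] [Algebra F E]

theorem baseIdeals_le_ambiguousIdeals : baseIdeals F E ≤ ambiguousIdeals F E := by
  rintro _ ⟨a, rfl⟩
  exact ⟨a ^ 3, map_pow _ _ _⟩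

theorem extendIdeal_principal_mem (x : Fˣ) :
    extendIdeal F E (principal F x) ∈ basePrincipalIdeals F E := ⟨_, ⟨x, rfl⟩, rfl⟩

theorem mem_basePrincipalIdeals_of_idealClass_eq_one {a : IdealGroup F}
    (h : idealClass F a = 1) : extendIdeal F E a ∈ basePrincipalIdeals F E := by
  obtain ⟨x, rfl⟩ := idealClass_eq_one_iff.1 h
  exact extendIdeal_principal_mem x

theorem idealClass_extendIdeal_of_mem {a : IdealGroup F}
    (h : extendIdeal F E a ∈ principalIdeals E) :
    ClassGroup.extendedHom (𝓞 F) (𝓞 E) (idealClass F a) = 1 := by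
  rw [extendedHom_idealClass]
  exact idealClass_eq_one_iff.2 h

theorem baseIdeals_le_basePrincipalIdeals_rat {E : Type*} [Field E] [NumberField E]
    [Algebra ℚ E] : baseIdeals ℚ E ≤ basePrincipalIdeals ℚ E := by
  rintro _ ⟨a, rfl⟩
  obtain ⟨x, hx⟩ := exists_principal_eq_pow_classNumber a
  rw [Rat.classNumber_eq, pow_one] at hx
  exact ⟨a, ⟨x, hx⟩, rfl⟩

theorem extendIdeal_idealNorm_pow (a : IdealGroup F) :
    idealNorm F E (extendIdeal F E a) = a ^ Module.finrank F E := by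
  have : (idealNorm F E).comp (extendIdeal F E) = powMonoidHom (Module.finrank F E) := by
    refine idealGroup_hom_ext fun x => ?_
    rw [MonoidHom.comp_apply, extendIdeal_principal, idealNorm_principal, powMonoidHom_apply,
      ← map_pow]
    congr 1
    ext1
    simp [Algebra.norm_algebraMap]
  exact DFunLike.congr_fun this a

/-- The capitulation kernel is killed by the degree. -/
theorem pow_eq_one_of_extendedHom_eq_one {c : ClassGroup (𝓞 F)}
    (h : ClassGroup.extendedHom (𝓞 F) (𝓞 E) c = 1) : c ^ Module.finrank F E = 1 := by
  obtain ⟨a, rfl⟩ := idealClass_surjective c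
  rw [extendedHom_idealClass, idealClass_eq_one_iff] at h
  obtain ⟨x, hx⟩ := h
  rw [← map_pow, ← extendIdeal_idealNorm_pow (E := E), ← hx, idealNorm_principal,
    idealClass_principal]

end Ambiguous

/-- A tower consisting of a totally real cyclic cubic extension `N/K` of a quadratic field, a
subfield `L` with `[N : L] = 2`, and the nontrivial automorphism `τ` of `N/L`, which restricts to
the nontrivial automorphism `τK` of `K`. -/
structure CubicTower (K L N : Type*) [Field K] [Field L] [Field N] [NumberField K] [NumberField L]
    [NumberField N] [Algebra K N] [Algebra L N] where
  /-- a generator of the Galois group -/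
  σ : N ≃ₐ[K] N
  /-- the conjugation of `N/L` -/
  τ : N ≃ₐ[L] N
  /-- the conjugation of `K` -/
  τK : K ≃+* K
  isGalois : IsGalois K N
  totallyReal : IsTotallyReal N
  totallyReal_base : IsTotallyReal K
  finrank_base : Module.finrank ℚ K = 2
  finrank_top : Module.finrank ℚ N = 6
  finrank_cubic : Module.finrank K N = 3
  mem_zpowers : ∀ x, x ∈ Subgroup.zpowers σ
  norm_top : ∀ x, algebraMap L N (Algebra.norm L x) = x * τ x
  norm_base : ∀ x : K, algebraMap ℚ K (Algebra.norm ℚ x) = x * τK x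
  compat : ∀ x, τ (algebraMap K N x) = algebraMap K N (τK x)

/-! ### Ideals and invariants in the tower. -/

namespace CubicTower

variable {K L N : Type*} [Field K] [Field L] [Field N] [NumberField K] [NumberField L]
    [NumberField N] [Algebra K N] [Algebra L N]

/-- Conjugation of ideals by `τ`. -/
def conj (t : CubicTower K L N) : IdealGroup N →* IdealGroup N := galIdeal t.τ.toRingEquiv

theorem conj_extendIdeal (t : CubicTower K L N) (a : IdealGroup K) :
    t.conj (extendIdeal K N a) = extendIdeal K N (galIdeal t.τK a) :=
  galIdeal_extendIdeal _ _ t.compat a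

theorem mul_conj (t : CubicTower K L N) (A : IdealGroup N) : A * t.conj A = extendIdeal L N (idealNorm L N A) :=
  (extendIdeal_idealNorm _ t.norm_top A).symm

theorem conj_extendIdeal_cubic (t : CubicTower K L N) (D : IdealGroup L) :
    t.conj (extendIdeal L N D) = extendIdeal L N D := by
  rw [conj, galIdeal_extendIdeal _ (RingEquiv.refl L) (fun x => t.τ.commutes x), galIdeal_refl]

theorem extendIdeal_rat (a : IdealGroup ℚ) :
    extendIdeal L N (extendIdeal ℚ L a) = extendIdeal K N (extendIdeal ℚ K a) := by
  rw [extendIdeal_extendIdeal, extendIdeal_extendIdeal]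

/-- τ acts on ideals from K through the conjugation of K, so the product is the absolute norm of the
ideal. -/
theorem extendIdeal_mul_conj (t : CubicTower K L N) (a : IdealGroup K) :
    extendIdeal K N a * t.conj (extendIdeal K N a) =
      extendIdeal L N (extendIdeal ℚ L (idealNorm ℚ K a)) := by
  rw [t.conj_extendIdeal, ← map_mul, ← extendIdeal_idealNorm t.τK t.norm_base,
    ← extendIdeal_rat (L := L)]

/-- An ambiguous ideal of `L` whose extension to `N` comes from `K` is rational. -/
theorem mem_baseIdeals_of_extendIdeal_mem (t : CubicTower K L N) {D : IdealGroup L} (hD : D ∈ ambiguousIdeals ℚ L)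
    (h : extendIdeal L N D ∈ baseIdeals K N) : D ∈ baseIdeals ℚ L := by
  obtain ⟨c, hc⟩ := hD
  obtain ⟨b, hb⟩ := h
  -- Ideals from L are fixed by τ, so D² becomes b · τb in N, which is rational. As D³ is rational
  -- too, so is D = D³/D².
  have h2 : extendIdeal ℚ L (idealNorm ℚ K b) = D ^ 2 := by
    apply extendIdeal_injective (F := L) (E := N)
    rw [← t.extendIdeal_mul_conj, hb, t.conj_extendIdeal_cubic, map_pow, pow_two]
  refine ⟨c / idealNorm ℚ K b, ?_⟩
  rw [map_div, hc, h2, powMonoidHom_apply, pow_succ, mul_div_cancel_left]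

theorem extendIdeal_mem_ambiguousIdeals {D : IdealGroup L} (hD : D ∈ ambiguousIdeals ℚ L) :
    extendIdeal L N D ∈ ambiguousIdeals K N := by
  obtain ⟨c, hc⟩ := hD
  refine ⟨extendIdeal ℚ K c, ?_⟩
  rw [← extendIdeal_rat (L := L), hc, powMonoidHom_apply, powMonoidHom_apply, map_pow]

theorem extendIdeal_mem_base_of_mem {D : IdealGroup L} (hD : D ∈ baseIdeals ℚ L) :
    extendIdeal L N D ∈ baseIdeals K N := by
  obtain ⟨c, rfl⟩ := hD
  exact ⟨_, (extendIdeal_rat c).symm⟩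

theorem relativePrincipalIdeals_le :
    relativePrincipalIdeals K L N ≤ ambiguousIdeals K N := fun _ hA =>
  (sup_le inf_le_left baseIdeals_le_ambiguousIdeals : _ ≤ ambiguousIdeals K N) hA.1

theorem unitNorm_surjective (t : CubicTower K L N)
    (hX : ∀ A ∈ ambiguousPrincipalIdeals K N, ∀ B ∈ ambiguousPrincipalIdeals K N,
      B ∉ basePrincipalIdeals K N → ∃ k : ℤ, A * B ^ k ∈ basePrincipalIdeals K N) :
    Function.Surjective (unitNorm K N) ∧
      ∃ B ∈ ambiguousPrincipalIdeals K N, B ∉ basePrincipalIdeals K N :=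
  have := t.isGalois
  have := t.totallyReal
  have := t.totallyReal_base
  DPF.unitNorm_surjective t.finrank_base t.finrank_top t.finrank_cubic t.σ t.mem_zpowers hX

theorem invariantU_eq_zero (h : Function.Surjective (unitNorm K N)) : invariantU K N = 0 := by
  refine rankThree_eq_zero fun g => ⟨1, ?_⟩
  obtain ⟨y, rfl⟩ := QuotientGroup.mk_surjective g
  rw [one_pow]
  exact ((QuotientGroup.eq_one_iff y).2 (h y)).symm

theorem exists_fundamental_norm (t : CubicTower K L N) (h : Function.Surjective (unitNorm K N)) :
    ∃ H : (𝓞 N)ˣ, IsFundamentalUnit K (unitNorm K N H) := by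
  have := t.totallyReal_base
  obtain ⟨η, hη⟩ := exists_isFundamentalUnit t.finrank_base
  obtain ⟨H, rfl⟩ := h η
  exact ⟨H, hη⟩

theorem invariantR_eq_zero (h : relativePrincipalIdeals K L N ≤ baseIdeals K N) :
    invariantR K L N = 0 := by
  refine rankThree_eq_zero fun g => ⟨1, ?_⟩
  obtain ⟨y, rfl⟩ := QuotientGroup.mk_surjective g
  rw [one_pow]
  exact ((QuotientGroup.eq_one_iff y).2 (h y.2)).symm

theorem capitulation_pow_three (t : CubicTower K L N) {c : ClassGroup (𝓞 K)}
    (h : ClassGroup.extendedHom (𝓞 K) (𝓞 N) c = 1) : c ^ 3 = 1 := by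
  rw [← t.finrank_cubic]
  exact pow_eq_one_of_extendedHom_eq_one h

/-! ### The unramified case -/

/-- With all ramification indices 1, the valuations of a equal those of its extension A³. Hence a is
a cube b³ in K, and A = b by torsion-freeness. -/
theorem ambiguousIdeals_le_baseIdeals_of_isUnramified (h : IsUnramifiedExtension K N) :
    ambiguousIdeals K N ≤ baseIdeals K N := by
  rintro A ⟨a, ha⟩
  obtain ⟨b, rfl⟩ := exists_pow_eq_of_dvd_count (n := 3) a fun v => by
    obtain ⟨w, hw⟩ := exists_liesOver (N := N) v
    have h1 := count_extendIdeal v w a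
    rw [ramificationIdx_eq_one_of_isUnramifiedExtension h, ha, powMonoidHom_apply,
      Units.val_pow_eq_pow_val, FractionalIdeal.count_pow, Nat.cast_one, one_mul] at h1
    exact ⟨_, h1.symm⟩
  exact ⟨b, idealGroup_pow_injective (n := 3) (by norm_num) (by rw [← map_pow, ha]; rfl)⟩

/-- Under `hI` the quotient P_{N/K}/P_K is the capitulation kernel. It is killed by 3, so the class
rank bounds it and `unitNorm_surjective` makes it nontrivial. -/
theorem hasType_delta1 (t : CubicTower K L N) (hI : ambiguousIdeals K N ≤ baseIdeals K N)
    (hr : rankThree (ClassGroup (𝓞 K)) = 1) :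
    HasType K L N .delta1 ∧ ∃ H : (𝓞 N)ˣ, IsFundamentalUnit K (unitNorm K N H) := by
  have hcap : ∀ c d : ClassGroup (𝓞 K), ClassGroup.extendedHom (𝓞 K) (𝓞 N) c = 1 →
      ClassGroup.extendedHom (𝓞 K) (𝓞 N) d = 1 → d ≠ 1 → ∃ k : ℤ, c * d ^ k = 1 :=
    fun c d hc hd => exists_mul_zpow_eq_one_of_rankThree_eq_one hr c d
      (t.capitulation_pow_three hc) (t.capitulation_pow_three hd)
  obtain ⟨hsurj, B, hB, hB'⟩ := t.unitNorm_surjective (by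
    intro A hA B hB hB'
    obtain ⟨a, rfl⟩ := hI hA.1
    obtain ⟨b, rfl⟩ := hI hB.1
    obtain ⟨k, hk⟩ := hcap _ _ (idealClass_extendIdeal_of_mem hA.2)
      (idealClass_extendIdeal_of_mem hB.2)
      fun h => hB' (mem_basePrincipalIdeals_of_idealClass_eq_one h)
    refine ⟨k, ?_⟩
    rw [← map_zpow, ← map_mul]
    apply mem_basePrincipalIdeals_of_idealClass_eq_one
    rw [map_mul, map_zpow, hk])
  refine ⟨⟨?_, ?_, ?_, ?_⟩, t.exists_fundamental_norm hsurj⟩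
  · rw [invariantU_eq_zero hsurj]; simp [PFType.invariants]
  · simp only [PFType.invariants, Nat.cast_zero]
    refine rankThree_eq_zero fun g => ⟨1, ?_⟩
    obtain ⟨y, rfl⟩ := QuotientGroup.mk_surjective g
    rw [one_pow]
    refine ((QuotientGroup.eq_one_iff y).2 ?_).symm
    exact baseIdeals_le_basePrincipalIdeals_rat (t.mem_baseIdeals_of_extendIdeal_mem y.2.1
      (hI (extendIdeal_mem_ambiguousIdeals y.2.1)))
  · rw [invariantR_eq_zero (relativePrincipalIdeals_le.trans hI)]; simp [PFType.invariants]
  · simp only [PFType.invariants, Nat.cast_one]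
    obtain ⟨b, rfl⟩ := hI hB.1
    refine rankThree_eq_one (fun g => Subtype.ext (t.capitulation_pow_three g.2))
      ⟨idealClass K b, idealClass_extendIdeal_of_mem hB.2⟩ (fun h => hB' ?_) fun g => ?_
    · exact mem_basePrincipalIdeals_of_idealClass_eq_one (congrArg Subtype.val h)
    · obtain ⟨k, hk⟩ := hcap g _ g.2 (idealClass_extendIdeal_of_mem hB.2)
        fun h => hB' (mem_basePrincipalIdeals_of_idealClass_eq_one h)
      exact ⟨k, Subtype.ext hk⟩

/-! ### The case of a single ramified prime -/

theorem mem_baseIdeals_of_sq_mem {A : IdealGroup N} (hA : A ∈ ambiguousIdeals K N)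
    (h : A ^ 2 ∈ baseIdeals K N) : A ∈ baseIdeals K N := by
  have h3 : A ^ 3 ∈ baseIdeals K N := hA
  have := div_mem h3 h
  rwa [pow_succ A 2, mul_div_cancel_left] at this

/-- Only v₀ can obstruct an ambiguous ideal from coming from K. Stability of v₀ under conjugation is
what separates absolute from relative principal factors. -/
theorem hasType_epsilon (t : CubicTower K L N) (v₀ : HeightOneSpectrum (𝓞 K))
    (hv : ∀ (v : HeightOneSpectrum (𝓞 K)) (w : HeightOneSpectrum (𝓞 N)),
      w.asIdeal.LiesOver v.asIdeal → v ≠ v₀ → v.asIdeal.ramificationIdx' w.asIdeal = 1)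
    (hv₀ : ∀ e : K ≃+* K,
      v₀.asIdeal.map (RingOfIntegers.mapRingEquiv e : 𝓞 K →+* 𝓞 K) = v₀.asIdeal)
    (hh : ¬ 3 ∣ classNumber K) :
    HasType K L N .epsilon ∧ ∃ H : (𝓞 N)ˣ, IsFundamentalUnit K (unitNorm K N H) := by
  have hcap : ∀ c : ClassGroup (𝓞 K), ClassGroup.extendedHom (𝓞 K) (𝓞 N) c = 1 → c = 1 := by
    intro c hc
    have h1 := orderOf_dvd_of_pow_eq_one (t.capitulation_pow_three hc)
    have h2 : orderOf c ∣ classNumber K := orderOf_dvd_card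
    rw [← orderOf_eq_one_iff]
    rcases (Nat.dvd_prime Nat.prime_three).1 h1 with h | h
    · exact h
    · exact absurd (h ▸ h2) hh
  have hPI : ∀ A ∈ ambiguousPrincipalIdeals K N, A ∈ baseIdeals K N →
      A ∈ basePrincipalIdeals K N := by
    rintro _ hA ⟨a, rfl⟩
    exact mem_basePrincipalIdeals_of_idealClass_eq_one
      (hcap _ (idealClass_extendIdeal_of_mem hA.2))
  -- Away from v₀ the argument of the unramified case applies, so the valuation at v₀ modulo 3
  -- decides.
  have hcount : ∀ A a, extendIdeal K N a = A ^ 3 →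
      (3 : ℤ) ∣ FractionalIdeal.count K v₀ (a : FractionalIdeal (𝓞 K)⁰ K) →
        A ∈ baseIdeals K N := by
    intro A a ha h3
    obtain ⟨b, rfl⟩ := exists_pow_eq_of_dvd_count (n := 3) a fun v => by
      rcases eq_or_ne v v₀ with rfl | hne
      · exact h3
      obtain ⟨w, hw⟩ := exists_liesOver (N := N) v
      have h1 := count_extendIdeal v w a
      rw [hv v w hw hne, ha, Units.val_pow_eq_pow_val, FractionalIdeal.count_pow, Nat.cast_one,
        one_mul] at h1
      exact ⟨_, h1.symm⟩
    exact ⟨b, idealGroup_pow_injective (n := 3) (by norm_num) (by rw [← map_pow, ha])⟩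
  have hone : ∀ A ∈ ambiguousIdeals K N, ∀ B ∈ ambiguousIdeals K N, B ∉ baseIdeals K N →
      ∃ k : ℤ, A * B ^ k ∈ baseIdeals K N := by
    rintro A ⟨a, ha⟩ B ⟨b, hb⟩ hB
    have hb3 := mt (hcount B b hb) hB
    set x := FractionalIdeal.count K v₀ (a : FractionalIdeal (𝓞 K)⁰ K)
    set y := FractionalIdeal.count K v₀ (b : FractionalIdeal (𝓞 K)⁰ K) with hy
    -- y is prime to 3, hence y² ≡ 1 and x - xy · y ≡ 0 modulo 3.
    refine ⟨-(x * y), hcount _ (a * b ^ (-(x * y))) ?_ ?_⟩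
    · rw [map_mul, map_zpow, ha, hb, powMonoidHom_apply, powMonoidHom_apply, mul_pow, ← zpow_natCast,
        ← zpow_natCast, ← zpow_natCast, ← zpow_mul, ← zpow_mul, mul_comm (-(x * y))]
    · rw [count_mul_unit, Units.val_zpow_eq_zpow_val, FractionalIdeal.count_zpow, ← hy]
      have : x + -(x * y) * y = x * (1 - y * y) := by ring
      rw [this]
      refine Dvd.dvd.mul_left ?_ _
      have hmod : y % 3 = 1 ∨ y % 3 = 2 := by omega
      rw [Int.dvd_iff_emod_eq_zero, Int.sub_emod, Int.mul_emod]
      rcases hmod with h | h <;> rw [h] <;> rfl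
  have hconj : ∀ A ∈ ambiguousIdeals K N, t.conj A / A ∈ baseIdeals K N := by
    rintro A ⟨a, ha⟩
    refine hcount _ (galIdeal t.τK a / a) ?_ ?_
    · rw [map_div, ← t.conj_extendIdeal, ha, powMonoidHom_apply, map_pow, div_pow]
    · have h1 := count_mul_unit v₀ (galIdeal t.τK a / a) a
      rw [div_mul_cancel, count_galIdeal v₀ t.τK (hv₀ _)] at h1
      have : FractionalIdeal.count K v₀
          ((galIdeal t.τK a / a : IdealGroup K) : FractionalIdeal (𝓞 K)⁰ K) = 0 := by linarith
      rw [this]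
      exact dvd_zero 3
  -- Modulo I_K the product is A², while A³ lies in I_K anyway.
  have hmc : ∀ A ∈ ambiguousIdeals K N, A * t.conj A ∈ baseIdeals K N → A ∈ baseIdeals K N := by
    intro A hA h
    refine mem_baseIdeals_of_sq_mem hA ?_
    have := div_mem h (hconj A hA)
    rwa [mul_div_assoc, div_div_cancel, ← pow_two] at this
  obtain ⟨hsurj, B, hB, hB'⟩ := t.unitNorm_surjective (by
    intro A hA B hB hB'
    obtain ⟨k, hk⟩ := hone A hA.1 B hB.1 (mt (hPI B hB) hB')
    exact ⟨k, hPI _ (mul_mem hA (zpow_mem hB k)) hk⟩)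
  have hBI : B ∉ baseIdeals K N := mt (hPI B hB) hB'
  refine ⟨⟨?_, ?_, ?_, ?_⟩, t.exists_fundamental_norm hsurj⟩
  · rw [invariantU_eq_zero hsurj]; simp [PFType.invariants]
  · simp only [PFType.invariants, Nat.cast_one]
    -- The generator for A is the norm to L of the nontrivial principal factor (β); by `hmc` its
    -- extension to N stays outside I_K.
    obtain ⟨β, rfl⟩ := hB.2
    set D := idealNorm L N (principal N β) with hD
    have hext : extendIdeal L N D = principal N β * t.conj (principal N β) := (t.mul_conj _).symm
    have hDamb : D ∈ ambiguousIdeals ℚ L := by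
      obtain ⟨a, ha⟩ := hB.1
      refine ⟨idealNorm ℚ K a, ?_⟩
      apply extendIdeal_injective (F := L) (E := N)
      rw [← t.extendIdeal_mul_conj, ha, powMonoidHom_apply, powMonoidHom_apply, map_pow, map_pow,
        hext, mul_pow]
    have hDp : D ∈ ambiguousPrincipalIdeals ℚ L :=
      ⟨hDamb, ⟨_, (idealNorm_principal β).symm⟩⟩
    have hDI : extendIdeal L N D ∉ baseIdeals K N := fun h => hBI (hmc _ hB.1 (hext ▸ h))
    refine rankThree_eq_one (fun g => ?_) (QuotientGroup.mk ⟨D, hDp⟩) (fun h => ?_) fun g => ?_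
    · obtain ⟨y, rfl⟩ := QuotientGroup.mk_surjective g
      rw [← QuotientGroup.mk_pow]
      refine (QuotientGroup.eq_one_iff _).2 ?_
      exact baseIdeals_le_basePrincipalIdeals_rat y.2.1
    · obtain ⟨c, -, hc⟩ := Subgroup.mem_subgroupOf.1 ((QuotientGroup.eq_one_iff _).1 h)
      exact hDI (extendIdeal_mem_base_of_mem ⟨c, hc⟩)
    · obtain ⟨y, rfl⟩ := QuotientGroup.mk_surjective g
      obtain ⟨k, hk⟩ := hone _ (extendIdeal_mem_ambiguousIdeals y.2.1) _
        (extendIdeal_mem_ambiguousIdeals hDamb) hDI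
      refine ⟨k, ?_⟩
      rw [← QuotientGroup.mk_zpow, ← QuotientGroup.mk_mul]
      refine (QuotientGroup.eq_one_iff _).2 (baseIdeals_le_basePrincipalIdeals_rat ?_)
      refine t.mem_baseIdeals_of_extendIdeal_mem (mul_mem y.2.1 (zpow_mem hDamb k)) ?_
      change extendIdeal L N (y * D ^ k) ∈ _
      rw [map_mul, map_zpow]
      exact hk
  · rw [invariantR_eq_zero fun A hA => hmc A (relativePrincipalIdeals_le hA) (by
      rw [t.mul_conj]
      exact extendIdeal_mem_base_of_mem hA.2)]
    simp [PFType.invariants]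
  · simp only [PFType.invariants, Nat.cast_zero]
    exact rankThree_eq_zero fun g => ⟨1, by rw [one_pow]; exact (Subtype.ext (hcap g g.2)).symm⟩

end CubicTower

/-! ### Building the tower from the Galois group. -/

theorem algebraMap_norm_quadratic {F E : Type*} [Field F] [Field E] [Algebra F E]
    [FiniteDimensional F E] [IsGalois F E] (h : Module.finrank F E = 2) (τ : E ≃ₐ[F] E)
    (hτ : τ ≠ 1) (x : E) : algebraMap F E (Algebra.norm F x) = x * τ x := by
  classical
  have hcard : Fintype.card (E ≃ₐ[F] E) = 2 := by
    rw [← Nat.card_eq_fintype_card, IsGalois.card_aut_eq_finrank, h]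
  have huniv : (Finset.univ : Finset (E ≃ₐ[F] E)) = {1, τ} := by
    symm
    rw [← Finset.card_eq_iff_eq_univ, Finset.card_pair hτ.symm, hcard]
  rw [Algebra.norm_eq_prod_automorphisms, huniv, Finset.prod_pair hτ.symm, AlgEquiv.one_apply]

/-- The tower of a totally real Galois extension of degree six. -/
theorem nonempty_cubicTower (N : Type*) [Field N] [NumberField N] [IsGalois ℚ N]
    [IsTotallyReal N] (hN : Nonempty ((N ≃ₐ[ℚ] N) ≃* Equiv.Perm (Fin 3)))
    (K L : IntermediateField ℚ N) (hK : Module.finrank ℚ K = 2) (hL : Module.finrank ℚ L = 3) :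
    Nonempty (CubicTower K L N) := by
  obtain ⟨e⟩ := hN
  have h6 : Module.finrank ℚ N = 6 := by
    rw [← IsGalois.card_aut_eq_finrank, Nat.card_congr e.toEquiv, Nat.card_perm, Nat.card_fin]
    rfl
  have hKN : Module.finrank K N = 3 := by
    have := Module.finrank_mul_finrank ℚ K N
    rw [hK, h6] at this
    omega
  have hLN : Module.finrank L N = 2 := by
    have := Module.finrank_mul_finrank ℚ L N
    rw [hL, h6] at this
    omega
  have hcK : Nat.card (N ≃ₐ[K] N) = 3 := by rw [IsGalois.card_aut_eq_finrank, hKN]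
  have hcL : Nat.card (N ≃ₐ[L] N) = 2 := by rw [IsGalois.card_aut_eq_finrank, hLN]
  have : Fact (Nat.Prime 3) := ⟨Nat.prime_three⟩
  have hcyc : IsCyclic (N ≃ₐ[K] N) := isCyclic_of_prime_card hcK
  obtain ⟨σ, hσ⟩ := hcyc.exists_generator
  have : Nontrivial (N ≃ₐ[L] N) := Finite.one_lt_card_iff_nontrivial.1 (by rw [hcL]; norm_num)
  obtain ⟨τ, hτ⟩ := exists_ne (1 : N ≃ₐ[L] N)
  have hquad : Algebra.IsQuadraticExtension ℚ K := ⟨hK⟩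
  have hgal : IsGalois ℚ K := inferInstance
  let ρ : K ≃ₐ[ℚ] K := (τ.restrictScalars ℚ).restrictNormal K
  have hcomm : ∀ x : K, τ (algebraMap K N x) = algebraMap K N (ρ x) := fun x =>
    ((τ.restrictScalars ℚ).restrictNormal_commutes K x).symm
  have hρ : ρ ≠ 1 := by
    -- If τ were trivial on K it would lie in Gal(N/K), of order 3, although τ² = 1; so τ would be
    -- trivial.
    intro h
    let τ' : N ≃ₐ[K] N := AlgEquiv.ofRingEquiv (f := τ.toRingEquiv) fun x => by
      refine (hcomm x).trans ?_
      rw [h, AlgEquiv.one_apply]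
    have h2 : τ' ^ 2 = 1 := by
      have := pow_card_eq_one' (x := τ)
      rw [hcL] at this
      ext x
      exact DFunLike.congr_fun this x
    have h3 : τ' ^ 3 = 1 := by rw [← hcK]; exact pow_card_eq_one'
    rw [pow_succ, h2, one_mul] at h3
    exact hτ (AlgEquiv.ext fun x => DFunLike.congr_fun h3 x)
  exact ⟨{
    σ := σ
    τ := τ
    τK := ρ.toRingEquiv
    isGalois := inferInstance
    totallyReal := inferInstance
    totallyReal_base := inferInstance
    finrank_base := by convert hK
    finrank_top := by convert h6
    finrank_cubic := hKN
    mem_zpowers := hσ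
    norm_top := algebraMap_norm_quadratic hLN τ hτ
    norm_base := fun x => by
      convert algebraMap_norm_quadratic hK ρ hρ x
      rfl
    compat := hcomm }⟩

end DPF

end

theorem mainTheorem10 (N : Type*) [Field N] [NumberField N] [IsGalois ℚ N]
    [NumberField.IsTotallyReal N] (hN : Nonempty ((N ≃ₐ[ℚ] N) ≃* Equiv.Perm (Fin 3)))
    (K L : IntermediateField ℚ N) (hK : Module.finrank ℚ K = 2) (hL : Module.finrank ℚ L = 3) :
    (DPF.IsUnramifiedExtension K N → DPF.rankThree (ClassGroup (NumberField.RingOfIntegers K)) = 1 →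
      DPF.HasType K L N .delta1 ∧
      ∃ H : (NumberField.RingOfIntegers N)ˣ,
        DPF.IsFundamentalUnit K (DPF.unitNorm K N H)) ∧
    ((∃ q : ℕ, (DPF.conductor K N).primeFactors = {q} ∧ DPF.DoesNotSplit K q) →
      ¬ 3 ∣ NumberField.classNumber K →
      DPF.HasType K L N .epsilon ∧
      ∃ H : (NumberField.RingOfIntegers N)ˣ,
        DPF.IsFundamentalUnit K (DPF.unitNorm K N H)) := by
  obtain ⟨t⟩ := DPF.nonempty_cubicTower N hN K L hK hL
  refine ⟨fun hunr hr => t.hasType_delta1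
    (DPF.CubicTower.ambiguousIdeals_le_baseIdeals_of_isUnramified hunr) hr, ?_⟩
  rintro ⟨q, hf, hq⟩ hh
  obtain ⟨v₀, hv, hv₀⟩ := DPF.exists_ramified_prime hf hq
  exact t.hasType_epsilon v₀ hv hv₀ hh
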